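/- Let $G$ be a discrete group, $\beta$ a (global) action of $G$ on a C*-algebra $B$ by *-automorphisms, and $A$ a closed two-sided ideal of $B$ such that the norm closure of $\sum_{t\in G}\beta_t(A)$ is $B$; that is, $\beta$ is the C*-enveloping action of the restricted C*-partial action $\alpha:=\beta|_A=\{\alpha_t\colon A_{t^{-1}}\to A_t\}_{t\in G}$, where $A_t=A\cap\beta_t(A)$ and $\alpha_t(a)=\beta_t(a)$ for $a\in A_{t^{-1}}$. Let $A''$ and $B''$ be the bidual (enveloping) W*-algebras, let $\beta''$ be the action of $G$ on $B''$ given by the double transposes $\beta_t''$, and let $\alpha''=\{\alpha_t''\colon A_{t^{-1}}''\to A_t''\}_{t\in G}$ be the bidual W*-partial action on $A''$, where $A_t''$ is viewed as a W*-ideal of $A''$. (1) $(B'',\beta'')$, together with the canonical inclusion $\iota\colon A''\to B''$ (the double transpose of $A\hookrightarrow B$), is the W*-enveloping action of $(A'',\alpha'')$: the map $\iota$ is an isomorphism of W*-partial actions from $\alpha''$ onto the restriction of $\beta''$ to the W*-ideal $\iota(A'')$ of $B''$, and the linear span of $\bigcup_{t\in G}\beta''_t(\iota(A''))$ is weak-*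 dense in $B''$. (2) $\alpha$ is AD-amenable if and only if $\beta$ is AD-amenable. Here a global action $\sigma$ of $G$ on a W*-algebra $N$ by weak-* continuous *-automorphisms is W*AD-amenable if there is a linear, positive, contractive map $P\colon\ell^\infty(G,N)\to N$ which is $G$-equivariant for the diagonal action $(\tilde\sigma_tf)(r)=\sigma_t(f(t^{-1}r))$ on $\ell^\infty(G,N)$ and sends each constant function to its value; a W*-partial action is W*AD-amenable if its W*-enveloping action (which exists and is unique up to isomorphism) is; and a C*-action or C*-partial action is AD-amenable if its bidual W*-action, respectively W*-partial action, is W*AD-amenable. -/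

import Mathlib

open scoped ENNReal Topology

universe u v w

noncomputable section

/-! ### Closed ideals of C*-algebras and partial actions on C*-algebras -/

/-- A C*-ideal (closed two-sided *-ideal) of a C*-algebra. -/
structure CStarIdeal (A : Type u) [NonUnitalCStarAlgebra A] where
  /-- the underlying C*-subalgebra -/
  alg : NonUnitalStarSubalgebra ℂ A
  isClosed : IsClosed (alg : Set A)
  mul_mem_left : ∀ a x : A, x ∈ alg → a * x ∈ alg
  mul_mem_right : ∀ a x : A, x ∈ alg → x * a ∈ alg

instance CStarIdeal.instIsClosed {A : Type u} [NonUnitalCStarAlgebra A] (J : CStarIdeal A) :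
    IsClosed (J.alg : Set A) := J.isClosed

/-- A C*-partial action `α = {α_t : A_{t⁻¹} → A_t}` of a discrete group `G` on `A`. -/
structure CStarPartialAction (G : Type v) [Group G] (A : Type u) [NonUnitalCStarAlgebra A] where
  /-- the ideal `A_t` -/
  dom : G → CStarIdeal A
  /-- the isomorphism `α_t : A_{t⁻¹} → A_t` -/
  act : ∀ t : G, (dom t⁻¹).alg ≃⋆ₐ[ℂ] (dom t).alg
  dom_one : ∀ a : A, a ∈ (dom 1).alg
  act_one : ∀ a : (dom 1⁻¹).alg, (act 1 a : A) = a
  act_mul : ∀ (s t : G) (x : (dom t⁻¹).alg) (h : (act t x : A) ∈ (dom s⁻¹).alg),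
    ∃ h' : (x : A) ∈ (dom (s * t)⁻¹).alg, (act (s * t) ⟨x, h'⟩ : A) = act s ⟨act t x, h⟩

section Restriction

variable {G : Type v} [Group G] {B : Type u} [NonUnitalCStarAlgebra B]
  (β : G →* (B ≃⋆ₐ[ℂ] B)) (A : CStarIdeal B)

theorem act_apply_inv (t : G) (b : B) : β t (β t⁻¹ b) = b := by
  rw [← StarAlgEquiv.mul_apply, ← map_mul]; simp

theorem act_inv_apply (t : G) (b : B) : β t⁻¹ (β t b) = b := by
  rw [← StarAlgEquiv.mul_apply, ← map_mul]; simp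

/-- The ideal `A_t = A ∩ β_t(A)` of `A`, written as `{a ∈ A | β_{t⁻¹}(a) ∈ A}`. -/
def restrictDom (t : G) : CStarIdeal A.alg where
  alg := (A.alg.comap (β t⁻¹ : B →⋆ₙₐ[ℂ] B)).comap (NonUnitalStarSubalgebraClass.subtype A.alg)
  isClosed := by
    have hc : Continuous fun a : A.alg => β t⁻¹ (a : B) :=
      (StarAlgEquiv.isometry (β t⁻¹)).continuous.comp continuous_subtype_val
    exact A.isClosed.preimage hc
  mul_mem_left a x hx := by
    change β t⁻¹ ((a : B) * (x : B)) ∈ A.alg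
    rw [map_mul]
    exact A.mul_mem_left _ _ hx
  mul_mem_right a x hx := by
    change β t⁻¹ ((x : B) * (a : B)) ∈ A.alg
    rw [map_mul]
    exact A.mul_mem_right _ _ hx

theorem mem_restrictDom {t : G} {a : A.alg} :
    a ∈ (restrictDom β A t).alg ↔ β t⁻¹ (a : B) ∈ A.alg := Iff.rfl

theorem mem_restrictDom_iff_image {t : G} {a : A.alg} :
    a ∈ (restrictDom β A t).alg ↔ (a : B) ∈ β t '' (A.alg : Set B) := by
  rw [mem_restrictDom]
  constructor
  · intro h
    exact ⟨_, h, act_apply_inv β t _⟩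
  · rintro ⟨c, hc, h⟩
    rw [← h, act_inv_apply]
    exact hc

theorem mem_restrictDom_inv {t : G} {a : A.alg} :
    a ∈ (restrictDom β A t⁻¹).alg ↔ β t (a : B) ∈ A.alg := by
  rw [mem_restrictDom, inv_inv]

/-- The restriction `β_t : A_{t⁻¹} → A_t`. -/
def restrictAct (t : G) : (restrictDom β A t⁻¹).alg ≃⋆ₐ[ℂ] (restrictDom β A t).alg where
  toFun x := ⟨⟨β t ((x : A.alg) : B), (mem_restrictDom_inv β A).1 x.2⟩, by
    rw [mem_restrictDom]
    simp only [act_inv_apply]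
    exact x.1.2⟩
  invFun x := ⟨⟨β t⁻¹ ((x : A.alg) : B), x.2⟩, by
    rw [mem_restrictDom_inv]
    simp only [act_apply_inv]
    exact x.1.2⟩
  left_inv x := Subtype.ext (Subtype.ext (act_inv_apply β t _))
  right_inv x := Subtype.ext (Subtype.ext (act_apply_inv β t _))
  map_add' x y := Subtype.ext (Subtype.ext (map_add (β t) _ _))
  map_mul' x y := Subtype.ext (Subtype.ext (map_mul (β t) _ _))
  map_star' x := Subtype.ext (Subtype.ext (map_star (β t) _))
  map_smul' c x := Subtype.ext (Subtype.ext (map_smul (β t) _ _))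

/-- The restriction `α = β|_A` of a global C*-action `β` on `B` to a C*-ideal `A` of `B`:
`A_t = A ∩ β_t(A)` and `α_t(a) = β_t(a)`. -/
def restrictAction : CStarPartialAction G A.alg where
  dom := restrictDom β A
  act := restrictAct β A
  dom_one a := by
    rw [mem_restrictDom]; simp
  act_one a := Subtype.ext (by change β 1 _ = _; simp)
  act_mul s t x h := by
    have key : β (s * t) ((x : A.alg) : B) = β s (β t ((x : A.alg) : B)) := by
      rw [map_mul, StarAlgEquiv.mul_apply]
    refine ⟨?_, Subtype.ext key⟩
    rw [mem_restrictDom_inv] at h ⊢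
    rw [key]
    exact h

/-- `β` is the C*-enveloping action of `β|_A`: the closed linear span of `⋃ t, β_t(A)` is `B`. -/
def IsCStarEnveloping : Prop :=
  closure (Submodule.span ℂ (⋃ t : G, β t '' (A.alg : Set B)) : Set B) = Set.univ

end Restriction

/-! ### W*-algebras, viewed as Banach space duals `M = (M_*)'` -/

/-- The weak-* topology of the dual of `E`. -/
abbrev wstar (E : Type u) [NormedAddCommGroup E] [NormedSpace ℂ E] :
    TopologicalSpace (StrongDual ℂ E) :=
  TopologicalSpace.induced StrongDual.toWeakDual (inferInstance : TopologicalSpace (WeakDual ℂ E))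

/-- A multiplication and an involution on the dual of `E`; no law is part of the data. -/
structure DualStarAlgebra (E : Type u) [NormedAddCommGroup E] [NormedSpace ℂ E] where
  mul : StrongDual ℂ E → StrongDual ℂ E → StrongDual ℂ E
  star : StrongDual ℂ E → StrongDual ℂ E

namespace DualStarAlgebra

variable {E : Type u} [NormedAddCommGroup E] [NormedSpace ℂ E] (M : DualStarAlgebra E)

/-- `M` is a W*-algebra with predual `E`: `E` is a Banach space, and `M = E'` with its dual norm
is a unital C*-algebra (Sakai's definition). -/
structure IsWStarAlgebra : Prop where
  complete : CompleteSpace E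
  mul_assoc : ∀ x y z, M.mul (M.mul x y) z = M.mul x (M.mul y z)
  add_mul : ∀ x y z, M.mul (x + y) z = M.mul x z + M.mul y z
  mul_add : ∀ x y z, M.mul x (y + z) = M.mul x y + M.mul x z
  smul_mul : ∀ (c : ℂ) (x y), M.mul (c • x) y = c • M.mul x y
  mul_smul : ∀ (c : ℂ) (x y), M.mul x (c • y) = c • M.mul x y
  exists_one : ∃ e, ∀ x, M.mul e x = x ∧ M.mul x e = x
  star_star : ∀ x, M.star (M.star x) = x
  star_add : ∀ x y, M.star (x + y) = M.star x + M.star y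
  star_smul : ∀ (c : ℂ) (x), M.star (c • x) = (starRingEnd ℂ c) • M.star x
  star_mul : ∀ x y, M.star (M.mul x y) = M.mul (M.star y) (M.star x)
  norm_mul_le : ∀ x y, ‖M.mul x y‖ ≤ ‖x‖ * ‖y‖
  norm_star_mul_self : ∀ x, ‖M.mul (M.star x) x‖ = ‖x‖ * ‖x‖

/-- A W*-ideal: a two-sided *-ideal that is closed in the weak-* topology. -/
structure IsWStarIdeal (I : Submodule ℂ (StrongDual ℂ E)) : Prop where
  mul_mem_left : ∀ a, ∀ x ∈ I, M.mul a x ∈ I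
  mul_mem_right : ∀ a, ∀ x ∈ I, M.mul x a ∈ I
  star_mem : ∀ x ∈ I, M.star x ∈ I
  isClosed : IsClosed[wstar E] (I : Set (StrongDual ℂ E))

/-- Positive elements: those of the form `y* y`. -/
def IsPos (x : StrongDual ℂ E) : Prop := ∃ y, x = M.mul (M.star y) y

end DualStarAlgebra

/-! ### W*-partial actions and W*-actions -/

/-- A family of linear maps `γ_t : M_{t⁻¹} → M_t` between subspaces of a vector space `X`. -/
structure PartialFamily (G : Type v) [Group G] (X : Type u) [AddCommGroup X] [Module ℂ X] where
  dom : G → Submodule ℂ X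
  act : ∀ t : G, dom t⁻¹ →ₗ[ℂ] dom t

section WStarActions

variable {G : Type v} [Group G] {E : Type u} [NormedAddCommGroup E] [NormedSpace ℂ E]
  {F : Type w} [NormedAddCommGroup F] [NormedSpace ℂ F]

/-- `γ` is a W*-partial action of the discrete group `G` on the W*-algebra `M`: it is a
set-theoretic partial action, each `M_t` is a W*-ideal and each `γ_t` is a W*-isomorphism. -/
structure IsWStarPartialAction (M : DualStarAlgebra E) (γ : PartialFamily G (StrongDual ℂ E)) :
    Prop where
  isWStarAlgebra : M.IsWStarAlgebra
  ideal : ∀ t, M.IsWStarIdeal (γ.dom t)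
  bijective : ∀ t, Function.Bijective (γ.act t)
  map_mul : ∀ (t : G) (x y z : γ.dom t⁻¹), (z : StrongDual ℂ E) = M.mul x y →
    (γ.act t z : StrongDual ℂ E) = M.mul (γ.act t x) (γ.act t y)
  map_star : ∀ (t : G) (x z : γ.dom t⁻¹), (z : StrongDual ℂ E) = M.star x →
    (γ.act t z : StrongDual ℂ E) = M.star (γ.act t x)
  wstar_continuous : ∀ t : G, Continuous[(wstar E).induced Subtype.val, wstar E]
    (fun x : γ.dom t⁻¹ => (γ.act t x : StrongDual ℂ E))
  dom_one : γ.dom 1 = ⊤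
  act_one : ∀ x : γ.dom 1⁻¹, (γ.act 1 x : StrongDual ℂ E) = x
  act_mul : ∀ (s t : G) (x : γ.dom t⁻¹) (h : (γ.act t x : StrongDual ℂ E) ∈ γ.dom s⁻¹),
    ∃ h' : (x : StrongDual ℂ E) ∈ γ.dom (s * t)⁻¹,
      (γ.act (s * t) ⟨x, h'⟩ : StrongDual ℂ E) = γ.act s ⟨γ.act t x, h⟩

/-- `σ` is a (global) W*-action of `G` on the W*-algebra `N`. -/
structure IsWStarAction (N : DualStarAlgebra F)
    (σ : G → StrongDual ℂ F →ₗ[ℂ] StrongDual ℂ F) : Prop where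
  isWStarAlgebra : N.IsWStarAlgebra
  map_mul : ∀ t x y, σ t (N.mul x y) = N.mul (σ t x) (σ t y)
  map_star : ∀ t x, σ t (N.star x) = N.star (σ t x)
  wstar_continuous : ∀ t, Continuous[wstar F, wstar F] (σ t)
  act_one : ∀ x, σ 1 x = x
  act_mul : ∀ s t x, σ (s * t) x = σ s (σ t x)

/-- `(N, σ)` is a W*-enveloping action of the W*-partial action `(M, γ)` through `ι : M → N`:
`ι` is an isomorphism of W*-partial actions from `γ` onto the restriction of `σ` to the W*-ideal
`ι(M)` of `N` (so `ι(M_t) = ι(M) ∩ σ_t(ι(M))`), and the linear `σ`-orbit of `ι(M)` is weak-*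
dense in `N`. -/
structure IsWStarEnveloping (M : DualStarAlgebra E) (γ : PartialFamily G (StrongDual ℂ E))
    (N : DualStarAlgebra F) (σ : G → StrongDual ℂ F →ₗ[ℂ] StrongDual ℂ F)
    (ι : StrongDual ℂ E →ₗ[ℂ] StrongDual ℂ F) : Prop where
  isWStarPartialAction : IsWStarPartialAction M γ
  isWStarAction : IsWStarAction N σ
  ideal : N.IsWStarIdeal (LinearMap.range ι)
  map_mul : ∀ x y, ι (M.mul x y) = N.mul (ι x) (ι y)
  map_star : ∀ x, ι (M.star x) = N.star (ι x)
  wstar_embedding : @Topology.IsEmbedding _ _ (wstar E) (wstar F) ι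
  map_dom : ∀ t, ι '' (γ.dom t) = Set.range ι ∩ σ t '' Set.range ι
  map_act : ∀ (t : G) (x : γ.dom t⁻¹), ι (γ.act t x) = σ t (ι x)
  dense : @closure _ (wstar F)
    (Submodule.span ℂ (⋃ t : G, σ t '' Set.range ι) : Set (StrongDual ℂ F)) = Set.univ

/-- W*AD-amenability of a global W*-action: there is a linear, positive, contractive, equivariant
map `P : ℓ^∞(G, N) → N` that restricts to the identity on constant functions, where `ℓ^∞(G, N)`
carries the diagonal action `(σ̃_t f)(r) = σ_t(f(t⁻¹ r))`. -/
def WStarADAmenable (N : DualStarAlgebra F)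
    (σ : G → StrongDual ℂ F →ₗ[ℂ] StrongDual ℂ F) : Prop :=
  ∃ P : lp (fun _ : G => StrongDual ℂ F) ∞ →ₗ[ℂ] StrongDual ℂ F,
    (∀ f h : lp (fun _ : G => StrongDual ℂ F) ∞,
      (∀ r, f r = N.mul (N.star (h r)) (h r)) → N.IsPos (P f)) ∧
    (∀ f, ‖P f‖ ≤ ‖f‖) ∧
    (∀ (t : G) (f g : lp (fun _ : G => StrongDual ℂ F) ∞),
      (∀ r, g r = σ t (f (t⁻¹ * r))) → P g = σ t (P f)) ∧
    (∀ (x : StrongDual ℂ F) (f : lp (fun _ : G => StrongDual ℂ F) ∞), (∀ r, f r = x) → P f = x)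

end WStarActions

/-- A W*-partial action is W*AD-amenable if its W*-enveloping action is W*AD-amenable. -/
def PartialWStarADAmenable {G : Type v} [Group G] {E : Type u} [NormedAddCommGroup E]
    [NormedSpace ℂ E] (M : DualStarAlgebra E) (γ : PartialFamily G (StrongDual ℂ E)) : Prop :=
  ∃ (F : Type (max u v)) (_ : NormedAddCommGroup F) (_ : NormedSpace ℂ F)
    (N : DualStarAlgebra F) (σ : G → StrongDual ℂ F →ₗ[ℂ] StrongDual ℂ F)
    (ι : StrongDual ℂ E →ₗ[ℂ] StrongDual ℂ F),
    IsWStarEnveloping M γ N σ ι ∧ WStarADAmenable N σ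

/-! ### The bidual W*-algebra and bidual partial actions -/

section Bidual

/-- The double transpose `f'' : E'' → F''`, given by `f''(Φ)(φ) = Φ(φ ∘ f)`. -/
def bidualMap {E : Type u} [NormedAddCommGroup E] [NormedSpace ℂ E]
    {F : Type w} [NormedAddCommGroup F] [NormedSpace ℂ F] (f : E →L[ℂ] F) :
    StrongDual ℂ (StrongDual ℂ E) →L[ℂ] StrongDual ℂ (StrongDual ℂ F) :=
  ContinuousLinearMap.precomp ℂ (ContinuousLinearMap.precomp ℂ f)

theorem bidualMap_apply {E : Type u} [NormedAddCommGroup E] [NormedSpace ℂ E]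
    {F : Type w} [NormedAddCommGroup F] [NormedSpace ℂ F] (f : E →L[ℂ] F)
    (Φ : StrongDual ℂ (StrongDual ℂ E)) (φ : StrongDual ℂ F) :
    bidualMap f Φ φ = Φ (φ.comp f) := rfl

/-- The double transpose of an inclusion is injective, by the Hahn-Banach theorem. -/
theorem bidualMap_subtypeL_injective {E : Type u} [NormedAddCommGroup E] [NormedSpace ℂ E]
    (p : Submodule ℂ E) : Function.Injective (bidualMap p.subtypeL) := by
  intro Φ Ψ h
  ext φ
  obtain ⟨g, hg, -⟩ := exists_extension_norm_eq p φ
  have hcomp : g.comp p.subtypeL = φ := by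
    ext x
    exact hg x
  have := DFunLike.congr_fun h g
  rwa [bidualMap_apply, bidualMap_apply, hcomp] at this

variable (A : Type u) [NonUnitalCStarAlgebra A]

variable {A} in
/-- `(Φ · φ)(a) = Φ(b ↦ φ(a b))` for `Φ ∈ A''` and `φ ∈ A'`, as a map `A' → A'`. -/
def arensAct (Φ : StrongDual ℂ (StrongDual ℂ A)) : StrongDual ℂ A →L[ℂ] StrongDual ℂ A :=
  (ContinuousLinearMap.compL ℂ A (StrongDual ℂ A) ℂ Φ).comp
    (((ContinuousLinearMap.compL ℂ A (A →L[ℂ] A) (StrongDual ℂ A)).flip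
      (ContinuousLinearMap.mul ℂ A)).comp (ContinuousLinearMap.compL ℂ A A ℂ))

theorem arensAct_apply (Φ : StrongDual ℂ (StrongDual ℂ A)) (φ : StrongDual ℂ A) (a : A) :
    arensAct Φ φ a = Φ (φ.comp (ContinuousLinearMap.mul ℂ A a)) := rfl

variable {A} in
/-- `φ*(a) = conj (φ(a*))` for `φ ∈ A'`. -/
def dualStar (φ : StrongDual ℂ A) : StrongDual ℂ A :=
  ((starL ℂ : ℂ ≃L⋆[ℂ] ℂ) : ℂ →L⋆[ℂ] ℂ).comp (φ.comp ((starL ℂ : A ≃L⋆[ℂ] A) : A →L⋆[ℂ] A))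

theorem dualStar_apply (φ : StrongDual ℂ A) (a : A) :
    dualStar φ a = star (φ (star a)) := rfl

/-- The map `φ ↦ φ*` as a continuous conjugate-linear map. -/
def dualStarL : StrongDual ℂ A →L⋆[ℂ] StrongDual ℂ A :=
  LinearMap.mkContinuous
    { toFun := dualStar
      map_add' := fun φ ψ => by ext a; simp [dualStar_apply]
      map_smul' := fun c φ => by ext a; simp [dualStar_apply] } 1 (fun φ => by
      rw [one_mul]
      refine ContinuousLinearMap.opNorm_le_bound _ (norm_nonneg _) fun a => ?_
      change ‖star (φ (star a))‖ ≤ _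
      rw [norm_star]
      exact (φ.le_opNorm _).trans_eq (by rw [norm_star]))

/-- The enveloping algebra `A''` of a C*-algebra `A`: the Banach space bidual with the (first)
Arens product `(Φ Ψ)(φ) = Φ(Ψ · φ)` and the involution `Φ*(φ) = conj (Φ(φ*))`. -/
def bidual : DualStarAlgebra (StrongDual ℂ A) where
  mul Φ Ψ := Φ.comp (arensAct Ψ)
  star Φ := ((starL ℂ : ℂ ≃L⋆[ℂ] ℂ) : ℂ →L⋆[ℂ] ℂ).comp (Φ.comp (dualStarL A))

theorem bidual_mul_apply (Φ Ψ : StrongDual ℂ (StrongDual ℂ A)) (φ : StrongDual ℂ A) :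
    (bidual A).mul Φ Ψ φ = Φ (arensAct Ψ φ) := rfl

theorem bidual_star_apply (Φ : StrongDual ℂ (StrongDual ℂ A)) (φ : StrongDual ℂ A) :
    (bidual A).star Φ φ = star (Φ (dualStar φ)) := rfl

variable {A}

/-- The inclusion of a C*-ideal as a continuous linear map. -/
def CStarIdeal.incl (J : CStarIdeal A) : J.alg →L[ℂ] A := J.alg.toSubmodule.subtypeL

theorem CStarIdeal.incl_apply (J : CStarIdeal A) (x : J.alg) : J.incl x = x := rfl

/-- The canonical embedding `J'' → A''` for a C*-ideal `J` of `A`. -/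
def CStarIdeal.bidualIncl (J : CStarIdeal A) :
    StrongDual ℂ (StrongDual ℂ J.alg) →ₗ[ℂ] StrongDual ℂ (StrongDual ℂ A) :=
  (bidualMap J.incl).toLinearMap

theorem CStarIdeal.bidualIncl_injective (J : CStarIdeal A) :
    Function.Injective J.bidualIncl :=
  bidualMap_subtypeL_injective J.alg.toSubmodule

/-- `J''`, viewed as a subspace of `A''`. -/
def CStarIdeal.bidualRange (J : CStarIdeal A) : Submodule ℂ (StrongDual ℂ (StrongDual ℂ A)) :=
  LinearMap.range J.bidualIncl

/-- `J''` is identified with its image in `A''`. -/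
def CStarIdeal.bidualEquiv (J : CStarIdeal A) :
    StrongDual ℂ (StrongDual ℂ J.alg) ≃ₗ[ℂ] J.bidualRange :=
  LinearEquiv.ofInjective J.bidualIncl J.bidualIncl_injective

/-- A *-isomorphism of C*-algebras as a (necessarily) continuous linear map. -/
def starIsoL {B : Type u} [NonUnitalCStarAlgebra B] (φ : A ≃⋆ₐ[ℂ] B) : A →L[ℂ] B where
  toFun := φ
  map_add' := map_add φ
  map_smul' := map_smul φ
  cont := (StarAlgEquiv.isometry φ).continuous

variable {G : Type v} [Group G]

/-- The bidual partial action `α''`: `A_t''` is viewed as a subspace of `A''`, and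
`α_t'' : A_{t⁻¹}'' → A_t''` is the double transpose of `α_t`. -/
def CStarPartialAction.bidual (α : CStarPartialAction G A) :
    PartialFamily G (StrongDual ℂ (StrongDual ℂ A)) where
  dom t := (α.dom t).bidualRange
  act t := (α.dom t).bidualEquiv.toLinearMap ∘ₗ
    (bidualMap (starIsoL (α.act t))).toLinearMap ∘ₗ (α.dom t⁻¹).bidualEquiv.symm.toLinearMap

/-- The bidual `β''` of a global C*-action `β`: `β_t''` is the double transpose of `β_t`. -/
def bidualAction (β : G →* (A ≃⋆ₐ[ℂ] A)) (t : G) :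
    StrongDual ℂ (StrongDual ℂ A) →ₗ[ℂ] StrongDual ℂ (StrongDual ℂ A) :=
  (bidualMap (starIsoL (β t))).toLinearMap

/-- AD-amenability of a global C*-action: `β''` is W*AD-amenable. -/
def ADAmenable (β : G →* (A ≃⋆ₐ[ℂ] A)) : Prop :=
  WStarADAmenable (bidual A) (bidualAction β)

/-- AD-amenability of a C*-partial action: `α''` is W*AD-amenable. -/
def CStarPartialAction.ADAmenable (α : CStarPartialAction G A) : Prop :=
  PartialWStarADAmenable (_root_.bidual A) α.bidual

end Bidual

end

/-!
The Arens product makes `B''` a W*-algebra: the C*-identity is read off the GNS representations of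
the quasi-states of `B`, whose vector functionals exhaust the unit ball of `B'` and whose orbit maps
extend to `B''`. For an ideal `J` the bidual `J''` is the annihilator of the annihilator of `J`.
This turns `A_t = A ∩ β_t(A)` into `A_t'' = A'' ∩ β_t''(A'')`, and the norm density of the span of
the orbit of `A` into the weak-* density of the span of the orbit of `A''`.

The second assertion follows from the uniqueness of enveloping actions. Let `p_t` be the central
projection `σ_t(ι 1)` of an enveloping action `(N, σ)` of `M`. An element of `N` is determined by
its components in the ideals `p_t N = σ_t(ι M)`, and conversely any bounded family of components
that agree on the overlaps `p_s p_t N` comes from an element of `N`. The overlaps, and the way in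
which components agree on them, depend only on the partial action on `M`, and therefore so does
`N`. Weak-* continuity of the multiplication by a central projection is all that is needed from the
theory of W*-algebras, and it holds because this multiplication is an M-projection of a dual
Banach space.
-/

noncomputable section

open scoped ComplexOrder InnerProductSpace
open Filter

/-! ### Quasi-states -/

section NormOneAtUnit

variable {U : Type*} [CStarAlgebra U]

theorem norm_add_mul_I_smul_one_sq_le {h : U} (hsa : IsSelfAdjoint h) (T : ℝ) :
    ‖h + (T * Complex.I) • (1 : U)‖ ^ 2 ≤ ‖h‖ ^ 2 + T ^ 2 := by
  have hone : ‖(1 : U)‖ ≤ 1 := by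
    rcases subsingleton_or_nontrivial U with _ | _
    · simp [Subsingleton.elim (1 : U) 0]
    · simp
  have hsq : star (h + (T * Complex.I) • (1 : U)) * (h + (T * Complex.I) • 1) =
      h * h + ((T ^ 2 : ℝ) : ℂ) • (1 : U) := by
    have hI : (T * Complex.I) * -(T * Complex.I) = ((T ^ 2 : ℝ) : ℂ) := by
      linear_combination (norm := (push_cast; ring)) (-(T : ℂ) ^ 2) * Complex.I_sq
    have hstar : star (T * Complex.I) = -(T * Complex.I) := by simp
    simp only [star_add, hsa.star_eq, star_smul, star_one, add_mul, mul_add, smul_mul_assoc,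
      mul_smul_comm, one_mul, mul_one, smul_add, smul_smul, hstar, hI]
    module
  calc ‖h + (T * Complex.I) • (1 : U)‖ ^ 2
      = ‖h * h + ((T ^ 2 : ℝ) : ℂ) • (1 : U)‖ := by
        rw [sq, ← CStarRing.norm_star_mul_self, hsq]
    _ ≤ ‖h * h‖ + ‖((T ^ 2 : ℝ) : ℂ) • (1 : U)‖ := norm_add_le _ _
    _ ≤ ‖h‖ ^ 2 + T ^ 2 * 1 := by
        rw [norm_smul, Complex.norm_real, Real.norm_of_nonneg (sq_nonneg T), sq ‖h‖]
        gcongr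
        exact norm_mul_le _ _
    _ = ‖h‖ ^ 2 + T ^ 2 := by rw [mul_one]

variable {g : StrongDual ℂ U} (hg : ‖g‖ ≤ 1) (hg_one : g 1 = 1)
include hg hg_one

theorem im_apply_eq_zero_of_isSelfAdjoint {h : U} (hsa : IsSelfAdjoint h) : (g h).im = 0 := by
  -- `h + iT` has squared norm at most `‖h‖² + T²`, while `Im g (h + iT) = Im g h + T`.
  have hquad (T : ℝ) : 2 * T * (g h).im ≤ ‖h‖ ^ 2 := by
    have hle := pow_le_pow_left₀ (abs_nonneg _) ((Complex.abs_im_le_norm _).trans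
      (g.le_of_opNorm_le hg (h + (T * Complex.I) • (1 : U)))) 2
    rw [one_mul, sq_abs, map_add, map_smul, hg_one] at hle
    simp only [smul_eq_mul, mul_one, Complex.add_im, Complex.im_ofReal_mul, Complex.I_im] at hle
    linarith [norm_add_mul_I_smul_one_sq_le hsa T, sq_nonneg (g h).im]
  by_contra hne
  have := hquad ((‖h‖ ^ 2 + 1) / (2 * (g h).im))
  rw [show 2 * ((‖h‖ ^ 2 + 1) / (2 * (g h).im)) * (g h).im = ‖h‖ ^ 2 + 1 by field_simp] at this
  linarith

theorem re_apply_nonneg_of_nonneg [PartialOrder U] [StarOrderedRing U] {h : U} (hh : 0 ≤ h) :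
    0 ≤ (g h).re := by
  have hle : h ≤ algebraMap ℝ U ‖h‖ := IsSelfAdjoint.le_algebraMap_norm_self
  have hnorm : ‖algebraMap ℝ U ‖h‖ - h‖ ≤ ‖h‖ := by
    rw [CStarAlgebra.norm_le_iff_le_algebraMap _ (norm_nonneg _) (sub_nonneg.2 hle)]
    exact sub_le_self _ hh
  have hcoe : algebraMap ℝ U ‖h‖ = (‖h‖ : ℂ) • (1 : U) := by
    rw [Algebra.algebraMap_eq_smul_one]; simp
  have hre : (g (algebraMap ℝ U ‖h‖ - h)).re ≤ ‖h‖ := (Complex.re_le_norm _).trans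
    (((g.le_of_opNorm_le hg _).trans_eq (one_mul _)).trans hnorm)
  rw [hcoe, map_sub, map_smul, hg_one, smul_eq_mul, mul_one, Complex.sub_re,
    Complex.ofReal_re] at hre
  linarith

theorem apply_star_mul_self_nonneg (y : U) : 0 ≤ g (star y * y) := by
  let := CStarAlgebra.spectralOrder U
  let := CStarAlgebra.spectralOrderedRing U
  exact Complex.nonneg_iff.2 ⟨re_apply_nonneg_of_nonneg hg hg_one (star_mul_self_nonneg y),
    (im_apply_eq_zero_of_isSelfAdjoint hg hg_one (IsSelfAdjoint.star_mul_self y)).symm⟩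

end NormOneAtUnit

/-- A character of the C*-algebra generated by `y* y`, extended by the Hahn-Banach theorem. -/
theorem exists_strongDual_map_one_apply_star_mul_self {U : Type*} [CStarAlgebra U] [Nontrivial U]
    (y : U) : ∃ g : StrongDual ℂ U, ‖g‖ ≤ 1 ∧ g 1 = 1 ∧ g (star y * y) = (‖y‖ : ℂ) ^ 2 := by
  let := CStarAlgebra.spectralOrder U
  let := CStarAlgebra.spectralOrderedRing U
  let h := star y * y
  have : IsStarNormal h := (IsSelfAdjoint.star_mul_self y).isStarNormal
  let S := StarAlgebra.elemental ℂ h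
  have hmem : (‖h‖ : ℂ) ∈ spectrum ℂ (⟨h, StarAlgebra.elemental.self_mem ℂ h⟩ : S) := by
    have : IsClosed (S : Set U) := StarAlgebra.elemental.isClosed ℂ h
    rw [StarSubalgebra.mem_spectrum_iff (S := S)]
    simpa using spectrum.algebraMap_mem ℂ
      (CStarAlgebra.norm_mem_spectrum_of_nonneg (star_mul_self_nonneg y))
  obtain ⟨f, hf⟩ := WeakDual.CharacterSpace.mem_spectrum_iff_exists.1 hmem
  obtain ⟨g, hg, hg_norm⟩ := exists_extension_norm_eq (𝕜 := ℂ) S.toSubalgebra.toSubmodule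
    (WeakDual.toStrongDual (f : WeakDual ℂ S))
  refine ⟨g, hg_norm.le.trans ((WeakDual.CharacterSpace.norm_le_norm_one f).trans (by simp)),
    (hg (1 : S)).trans (map_one f), (hg ⟨h, StarAlgebra.elemental.self_mem ℂ h⟩).trans ?_⟩
  refine hf.trans ?_
  rw [CStarRing.norm_star_mul_self]
  push_cast
  ring

theorem exists_eval_separating {E : Type*} [NormedAddCommGroup E] [NormedSpace ℂ E]
    {s : Set (WeakDual ℂ E)} (hs : Convex ℝ s) (hc : IsClosed s) {φ : WeakDual ℂ E} (hφ : φ ∉ s) :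
    ∃ (a : E) (c : ℝ), (∀ ψ ∈ s, (ψ a).re < c) ∧ c < (φ a).re := by
  have : IsScalarTower ℝ ℂ (WeakDual ℂ E) := inferInstanceAs (IsScalarTower ℝ ℂ (StrongDual ℂ E))
  obtain ⟨f, c, hf, hc⟩ := @RCLike.geometric_hahn_banach_closed_point ℂ (WeakDual ℂ E) _ _ _ s φ
    _ _ _ _ _ (WeakDual.withSeminorms ℂ E).toLocallyConvexSpace hs hc hφ
  obtain ⟨a, rfl⟩ := LinearMap.dualEmbedding_surjective (topDualPairing ℂ E) f
  exact ⟨a, c, hf, hc⟩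

section QuasiStates

variable {A : Type u} [NonUnitalCStarAlgebra A]

/-- The quasi-states of `A`: the positive functionals of norm at most one. -/
def quasiStates (A : Type u) [NonUnitalCStarAlgebra A] : Set (StrongDual ℂ A) :=
  {ω | ‖ω‖ ≤ 1 ∧ ∀ x : A, 0 ≤ ω (star x * x)}

theorem exists_quasiState_apply_star_mul_self (a : A) :
    ∃ ω ∈ quasiStates A, ω (star a * a) = (‖a‖ : ℂ) ^ 2 := by
  obtain ⟨g, hg, hg_one, hga⟩ :=
    exists_strongDual_map_one_apply_star_mul_self (a : Unitization ℂ A)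
  have hinr (x : A) : ‖Unitization.inrHom ℂ ℂ A x‖ ≤ 1 * ‖x‖ := by
    simp [Unitization.norm_inr (𝕜 := ℂ)]
  refine ⟨g.comp (LinearMap.mkContinuous (Unitization.inrHom ℂ ℂ A) 1 hinr), ⟨?_, fun x => ?_⟩, ?_⟩
  · refine ContinuousLinearMap.opNorm_le_bound _ zero_le_one fun x => ?_
    exact (g.le_of_opNorm_le hg _).trans ((one_mul _).trans_le (hinr x))
  · simpa using apply_star_mul_self_nonneg hg hg_one (x : Unitization ℂ A)
  · simpa [Unitization.norm_inr (𝕜 := ℂ)] using hga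

/-- A positive functional as a positive linear map for the spectral order. -/
def toPositiveLinearMap [PartialOrder A] [StarOrderedRing A] (ω : StrongDual ℂ A)
    (hω : ∀ x : A, 0 ≤ ω (star x * x)) : A →ₚ[ℂ] ℂ :=
  PositiveLinearMap.mk₀ ω.toLinearMap fun a ha => by
    obtain ⟨b, rfl⟩ := CStarAlgebra.nonneg_iff_eq_star_mul_self.1 ha
    exact hω b

theorem norm_apply_star_mul_sq_le (ω : StrongDual ℂ A) (hω : ∀ x : A, 0 ≤ ω (star x * x))
    (x y : A) : ‖ω (star y * x)‖ ^ 2 ≤ (ω (star y * y)).re * (ω (star x * x)).re := by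
  let := CStarAlgebra.spectralOrder A
  let := CStarAlgebra.spectralOrderedRing A
  let f := toPositiveLinearMap ω hω
  have hre (z : A) : 0 ≤ (ω (star z * z)).re := (Complex.nonneg_iff.1 (hω z)).1
  calc ‖ω (star y * x)‖ ^ 2
      ≤ (‖f.toPreGNS y‖ * ‖f.toPreGNS x‖) ^ 2 :=
        pow_le_pow_left₀ (norm_nonneg _) (norm_inner_le_norm (f.toPreGNS y) (f.toPreGNS x)) 2
    _ = (ω (star y * y)).re * (ω (star x * x)).re := by
        rw [mul_pow, f.preGNS_norm_def, f.preGNS_norm_def]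
        exact congr_arg₂ (· * ·) (Real.sq_sqrt (hre y)) (Real.sq_sqrt (hre x))

theorem isCompact_quasiStates :
    IsCompact {ω : WeakDual ℂ A | WeakDual.toStrongDual ω ∈ quasiStates A} := by
  have hpos : IsClosed {ω : WeakDual ℂ A | ∀ x : A, 0 ≤ ω (star x * x)} := by
    simp only [Set.ofPred_forall]
    exact isClosed_iInter fun x => isClosed_le continuous_const (WeakDual.eval_continuous _)
  convert (WeakDual.isCompact_closedBall (𝕜 := ℂ) (0 : StrongDual ℂ A) 1).inter_right hpos using 1
  ext ω
  simp [quasiStates, dist_zero_right]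

/-- `ω` dominates `φ` if `|φ(x)|² ≤ ω(x* x)` for all `x`; equivalently, `φ` is given by a vector of
norm at most one in the GNS space of `ω`. -/
def Dominates (ω φ : StrongDual ℂ A) : Prop :=
  ∀ x : A, ‖φ x‖ ^ 2 ≤ (ω (star x * x)).re

theorem Dominates.norm_le_one {ω φ : StrongDual ℂ A} (h : Dominates ω φ) (hω : ‖ω‖ ≤ 1) :
    ‖φ‖ ≤ 1 := by
  refine ContinuousLinearMap.opNorm_le_bound _ zero_le_one fun x => ?_
  refine le_of_sq_le_sq ?_ (by positivity)
  calc ‖φ x‖ ^ 2 ≤ ‖ω (star x * x)‖ := (h x).trans (Complex.re_le_norm _)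
    _ ≤ 1 * ‖star x * x‖ := ω.le_of_opNorm_le hω _
    _ = (1 * ‖x‖) ^ 2 := by rw [CStarRing.norm_star_mul_self]; ring

theorem Dominates.convexCombination {ω₁ ω₂ φ₁ φ₂ : StrongDual ℂ A} (h₁ : Dominates ω₁ φ₁)
    (h₂ : Dominates ω₂ φ₂) {a b : ℝ} (ha : 0 ≤ a) (hb : 0 ≤ b) (hab : a + b = 1) :
    Dominates (a • ω₁ + b • ω₂) (a • φ₁ + b • φ₂) := fun x => by
  calc ‖a • φ₁ x + b • φ₂ x‖ ^ 2
      ≤ (a * ‖φ₁ x‖ + b * ‖φ₂ x‖) ^ 2 := by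
        gcongr
        refine (norm_add_le _ _).trans_eq ?_
        rw [norm_smul, norm_smul, Real.norm_of_nonneg ha, Real.norm_of_nonneg hb]
    _ ≤ a * ‖φ₁ x‖ ^ 2 + b * ‖φ₂ x‖ ^ 2 :=
        (convexOn_pow 2).2 (norm_nonneg (φ₁ x)) (norm_nonneg (φ₂ x)) ha hb hab
    _ ≤ a * (ω₁ (star x * x)).re + b * (ω₂ (star x * x)).re := by
        gcongr
        exacts [h₁ x, h₂ x]
    _ = ((a • ω₁ + b • ω₂) (star x * x)).re := by simp

theorem convex_quasiStates : Convex ℝ (quasiStates A) := by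
  intro ω₁ h₁ ω₂ h₂ a b ha hb hab
  refine ⟨?_, fun x => ?_⟩
  · have hball := convex_closedBall (0 : StrongDual ℂ A) 1
    exact mem_closedBall_zero_iff.1 (hball (mem_closedBall_zero_iff.2 h₁.1)
      (mem_closedBall_zero_iff.2 h₂.1) ha hb hab)
  · change 0 ≤ a • ω₁ (star x * x) + b • ω₂ (star x * x)
    exact add_nonneg (smul_nonneg ha (h₁.2 x)) (smul_nonneg hb (h₂.2 x))

/-- The functionals dominated by some quasi-state, as a subset of the weak-* dual. -/
def dominatedFunctionals (A : Type u) [NonUnitalCStarAlgebra A] : Set (WeakDual ℂ A) :=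
  {φ | ∃ ω ∈ quasiStates A, Dominates ω (WeakDual.toStrongDual φ)}

theorem convex_dominatedFunctionals : Convex ℝ (dominatedFunctionals A) := by
  rintro φ₁ ⟨ω₁, hω₁, h₁⟩ φ₂ ⟨ω₂, hω₂, h₂⟩ a b ha hb hab
  exact ⟨_, convex_quasiStates hω₁ hω₂ ha hb hab, h₁.convexCombination h₂ ha hb hab⟩

theorem isClosed_dominatedFunctionals : IsClosed (dominatedFunctionals A) := by
  let ball : Set (WeakDual ℂ A) := WeakDual.toStrongDual ⁻¹' Metric.closedBall 0 1
  let K : Set (WeakDual ℂ A × WeakDual ℂ A) :=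
    (ball ×ˢ {ω | WeakDual.toStrongDual ω ∈ quasiStates A}) ∩
      {q | ∀ x : A, ‖q.1 x‖ ^ 2 ≤ (q.2 (star x * x)).re}
  have hK : IsCompact K := by
    refine ((WeakDual.isCompact_closedBall _ _).prod isCompact_quasiStates).inter_right ?_
    simp only [Set.ofPred_forall]
    refine isClosed_iInter fun x => isClosed_le ?_ ?_
    · exact (((WeakDual.eval_continuous x).comp continuous_fst).norm).pow 2
    · exact Complex.continuous_re.comp ((WeakDual.eval_continuous _).comp continuous_snd)
  convert (hK.image continuous_fst).isClosed
  ext φ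
  refine ⟨fun ⟨ω, hω, h⟩ => ⟨(φ, StrongDual.toWeakDual ω), ⟨⟨?_, hω⟩, h⟩, rfl⟩, ?_⟩
  · exact mem_closedBall_zero_iff.2 (h.norm_le_one hω.1)
  · rintro ⟨⟨φ', ω⟩, ⟨⟨-, hω⟩, h⟩, rfl⟩
    exact ⟨WeakDual.toStrongDual ω, hω, h⟩

theorem exists_dominates_apply_eq_norm (a : A) :
    ∃ ω ∈ quasiStates A, ∃ ψ, Dominates ω ψ ∧ ψ a = ‖a‖ := by
  obtain ⟨ω, hω, hωa⟩ := exists_quasiState_apply_star_mul_self a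
  refine ⟨ω, hω, (‖a‖ : ℂ)⁻¹ • ω.comp (ContinuousLinearMap.mul ℂ A (star a)), fun x => ?_, ?_⟩
  · have hCS := norm_apply_star_mul_sq_le ω hω.2 x a
    have hre : (ω (star a * a)).re = ‖a‖ ^ 2 := by rw [hωa]; norm_cast
    have hx : 0 ≤ (ω (star x * x)).re := (Complex.nonneg_iff.1 (hω.2 x)).1
    change ‖(‖a‖ : ℂ)⁻¹ • ω (star a * x)‖ ^ 2 ≤ _
    rw [norm_smul, mul_pow, norm_inv, Complex.norm_real, norm_norm]
    rcases eq_or_ne ‖a‖ 0 with h0 | h0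
    · simpa [h0] using hx
    · calc ‖a‖⁻¹ ^ 2 * ‖ω (star a * x)‖ ^ 2
          ≤ ‖a‖⁻¹ ^ 2 * (‖a‖ ^ 2 * (ω (star x * x)).re) := by rw [hre] at hCS; gcongr
        _ = (ω (star x * x)).re := by field_simp
  · change (‖a‖ : ℂ)⁻¹ * ω (star a * a) = _
    rw [hωa, sq, ← mul_assoc]
    exact inv_mul_mul_self _

/-- The functionals dominated by quasi-states form a weak-* closed convex set which attains the
norm of every `a : A`, so by Hahn-Banach separation it is the whole unit ball. -/
theorem exists_quasiState_dominates (φ : StrongDual ℂ A) (hφ : ‖φ‖ ≤ 1) :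
    ∃ ω ∈ quasiStates A, Dominates ω φ := by
  by_contra hn
  obtain ⟨a, c, hlt, hc⟩ := exists_eval_separating convex_dominatedFunctionals
    isClosed_dominatedFunctionals (φ := StrongDual.toWeakDual φ) hn
  obtain ⟨ω, hω, ψ, hψ, hψa⟩ := exists_dominates_apply_eq_norm a
  have hac : (ψ a).re < c := hlt (StrongDual.toWeakDual ψ) ⟨ω, hω, hψ⟩
  have hφa : (φ a).re ≤ ‖a‖ := (Complex.re_le_norm _).trans (by simpa using φ.le_of_opNorm_le hφ a)
  rw [hψa, Complex.ofReal_re] at hac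
  exact absurd hc (hφa.trans hac.le).not_gt

end QuasiStates

/-! ### The Arens product and the GNS representation -/

section GNS

variable {A : Type u} [NonUnitalCStarAlgebra A] [PartialOrder A] [StarOrderedRing A]
  (f : A →ₚ[ℂ] ℂ)

/-- The canonical map from a C*-algebra to the GNS Hilbert space of a positive functional. -/
def gnsEmbed : A →L[ℂ] f.GNS :=
  UniformSpace.Completion.toComplL.comp <|
    f.toPreGNS.toLinearMap.mkContinuousOfExistsBound <| by
      obtain ⟨C, hC⟩ := f.exists_norm_apply_le
      refine ⟨√C, fun a => ?_⟩
      rw [f.preGNS_norm_def]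
      refine Real.sqrt_le_iff.2 ⟨by positivity, ?_⟩
      calc (f (star a * a)).re ≤ C * ‖star a * a‖ := (Complex.re_le_norm _).trans (hC _)
        _ = (√C * ‖a‖) ^ 2 := by
          rw [CStarRing.norm_star_mul_self, mul_pow, Real.sq_sqrt C.coe_nonneg, sq]

theorem inner_gnsEmbed (a b : A) : ⟪gnsEmbed f a, gnsEmbed f b⟫_ℂ = f (star a * b) :=
  UniformSpace.Completion.inner_coe (f.toPreGNS a) (f.toPreGNS b)

theorem gnsNonUnitalStarAlgHom_gnsEmbed (a b : A) :
    f.gnsNonUnitalStarAlgHom a (gnsEmbed f b) = gnsEmbed f (a * b) :=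
  f.gnsNonUnitalStarAlgHom_apply_coe

/-- The orbit map `a ↦ π(a) η` of a vector of the GNS space. -/
def gnsOrbit (η : f.GNS) : A →L[ℂ] f.GNS :=
  LinearMap.mkContinuous
    { toFun := fun a => f.gnsNonUnitalStarAlgHom a η
      map_add' := fun a b => by rw [map_add, add_apply]
      map_smul' := fun z a => by rw [map_smul]; rfl } ‖η‖ fun a => by
    rw [mul_comm]
    exact ContinuousLinearMap.le_of_opNorm_le _
      (NonUnitalStarAlgHom.norm_apply_le f.gnsNonUnitalStarAlgHom a) η

theorem inner_gnsEmbed_mul (η : f.GNS) (a b : A) :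
    ⟪η, gnsEmbed f (a * b)⟫_ℂ = ⟪gnsOrbit f η (star a), gnsEmbed f b⟫_ℂ := by
  change _ = ⟪f.gnsNonUnitalStarAlgHom (star a) η, _⟫_ℂ
  rw [← gnsNonUnitalStarAlgHom_gnsEmbed, map_star, ContinuousLinearMap.star_eq_adjoint,
    ContinuousLinearMap.adjoint_inner_left]

theorem exists_gns_vector (φ : StrongDual ℂ A) (hφ : ∀ x, ‖φ x‖ ^ 2 ≤ (f (star x * x)).re) :
    ∃ η : f.GNS, ‖η‖ ≤ 1 ∧ ∀ b, φ b = ⟪η, gnsEmbed f b⟫_ℂ := by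
  have hnorm (a : f.PreGNS) : ‖φ (f.ofPreGNS a)‖ ≤ 1 * ‖a‖ := by
    rw [one_mul, f.preGNS_norm_def]
    exact Real.le_sqrt_of_sq_le (hφ _)
  let ψ₀ : f.PreGNS →L[ℂ] ℂ := (φ.toLinearMap ∘ₗ f.ofPreGNS.toLinearMap).mkContinuous 1 hnorm
  let c : f.PreGNS →L[ℂ] f.GNS := UniformSpace.Completion.toComplL
  let ψ : f.GNS →L[ℂ] ℂ := ψ₀.extend c
  have hψ (x : f.PreGNS) : ψ x = ψ₀ x :=
    ContinuousLinearMap.extend_eq _ UniformSpace.Completion.denseRange_coe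
      (UniformSpace.Completion.isUniformInducing_coe _) x
  have hψ_norm : ‖ψ‖ ≤ 1 := ContinuousLinearMap.opNorm_le_bound _ zero_le_one fun x => by
    refine UniformSpace.Completion.induction_on x (isClosed_le (by fun_prop) (by fun_prop))
      fun a => ?_
    rw [hψ, UniformSpace.Completion.norm_coe]
    exact hnorm a
  refine ⟨(InnerProductSpace.toDual ℂ f.GNS).symm ψ, by simpa using hψ_norm, fun b => ?_⟩
  rw [InnerProductSpace.toDual_symm_apply]
  exact (hψ (f.toPreGNS b)).symm

theorem exists_quasiState_gns_vector (φ : StrongDual ℂ A) :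
    ∃ (ω : StrongDual ℂ A) (hω : ω ∈ quasiStates A) (η : (toPositiveLinearMap ω hω.2).GNS),
      ‖η‖ ≤ ‖φ‖ ∧ ∀ b, φ b = ⟪η, gnsEmbed _ b⟫_ℂ := by
  have hcontr : ‖(‖φ‖ : ℂ)⁻¹ • φ‖ ≤ 1 := by
    rw [norm_smul, norm_inv, Complex.norm_real, norm_norm]
    exact inv_mul_le_one
  obtain ⟨ω, hω, hdom⟩ := exists_quasiState_dominates _ hcontr
  obtain ⟨η, hη, hη_inner⟩ := exists_gns_vector (toPositiveLinearMap ω hω.2) _ hdom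
  refine ⟨ω, hω, (‖φ‖ : ℂ) • η, ?_, fun b => ?_⟩
  · rw [norm_smul, Complex.norm_real, norm_norm]
    exact mul_le_of_le_one_right (norm_nonneg _) hη
  · rw [inner_smul_left, ← hη_inner, Complex.conj_ofReal]
    rcases eq_or_ne φ 0 with rfl | hφ
    · simp
    · have : (‖φ‖ : ℂ) ≠ 0 := by simpa using hφ
      exact (mul_inv_cancel_left₀ this (φ b)).symm

end GNS

section Arens

variable {A : Type u} [NonUnitalCStarAlgebra A]

section BidualExtend

variable {H : Type*} [NormedAddCommGroup H] [InnerProductSpace ℂ H] [CompleteSpace H]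

/-- The weak-* continuous extension `A'' → H` of a bounded operator `A → H` into a Hilbert
space. -/
def bidualExtend (Λ : A →L[ℂ] H) (Ψ : StrongDual ℂ (StrongDual ℂ A)) : H :=
  (InnerProductSpace.toDual ℂ H).symm
    (((starL ℂ : ℂ ≃L⋆[ℂ] ℂ) : ℂ →L⋆[ℂ] ℂ).comp
      ((Ψ.comp (ContinuousLinearMap.precomp ℂ Λ)).comp (innerSL ℂ)))

theorem inner_bidualExtend (Λ : A →L[ℂ] H) (Ψ : StrongDual ℂ (StrongDual ℂ A)) (h : H) :
    ⟪h, bidualExtend Λ Ψ⟫_ℂ = Ψ ((innerSL ℂ h).comp Λ) := by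
  rw [← inner_conj_symm, bidualExtend, InnerProductSpace.toDual_symm_apply]
  exact star_star _

theorem bidual_star_star (Φ : StrongDual ℂ (StrongDual ℂ A)) :
    (bidual A).star ((bidual A).star Φ) = Φ := by
  ext φ
  rw [bidual_star_apply, bidual_star_apply, star_star]
  congr 1
  ext a
  rw [dualStar_apply, dualStar_apply, star_star, star_star]

theorem bidual_mul_apply_eq_inner {φ : StrongDual ℂ A} {Λ T : A →L[ℂ] H}
    (hφ : ∀ a b, φ (a * b) = ⟪T (star a), Λ b⟫_ℂ) (Φ Ψ : StrongDual ℂ (StrongDual ℂ A)) :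
    (bidual A).mul Φ Ψ φ = ⟪bidualExtend T ((bidual A).star Φ), bidualExtend Λ Ψ⟫_ℂ := by
  have harens : arensAct Ψ φ = dualStar ((innerSL ℂ (bidualExtend Λ Ψ)).comp T) := by
    ext a
    have hcomp : φ.comp (ContinuousLinearMap.mul ℂ A a) = (innerSL ℂ (T (star a))).comp Λ := by
      ext b
      exact hφ a b
    rw [arensAct_apply, dualStar_apply, hcomp, ← inner_bidualExtend]
    exact (inner_conj_symm _ _).symm
  rw [bidual_mul_apply, ← inner_conj_symm, inner_bidualExtend, bidual_star_apply, harens]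
  exact (star_star _).symm

end BidualExtend

theorem bidual_star_mul (Φ Ψ : StrongDual ℂ (StrongDual ℂ A)) :
    (bidual A).star ((bidual A).mul Φ Ψ) =
      (bidual A).mul ((bidual A).star Ψ) ((bidual A).star Φ) := by
  let := CStarAlgebra.spectralOrder A
  let := CStarAlgebra.spectralOrderedRing A
  ext φ
  obtain ⟨ω, hω, η, -, hη⟩ := exists_quasiState_gns_vector φ
  have hφ (a b : A) : φ (a * b) = ⟪gnsOrbit _ η (star a), gnsEmbed _ b⟫_ℂ :=
    (hη _).trans (inner_gnsEmbed_mul _ η a b)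
  have hφ_star (a b : A) : dualStar φ (a * b) = ⟪gnsEmbed _ (star a), gnsOrbit _ η b⟫_ℂ := by
    rw [dualStar_apply, star_mul, hφ, star_star]
    exact inner_conj_symm _ _
  rw [bidual_star_apply, bidual_mul_apply_eq_inner hφ_star, bidual_mul_apply_eq_inner hφ,
    bidual_star_star]
  exact inner_conj_symm _ _

theorem norm_arensAct_le (Φ : StrongDual ℂ (StrongDual ℂ A)) (φ : StrongDual ℂ A) :
    ‖arensAct Φ φ‖ ≤ ‖Φ‖ * ‖φ‖ := by
  refine ContinuousLinearMap.opNorm_le_bound _ (by positivity) fun a => ?_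
  calc ‖Φ (φ.comp (ContinuousLinearMap.mul ℂ A a))‖
      ≤ ‖Φ‖ * (‖φ‖ * ‖ContinuousLinearMap.mul ℂ A a‖) :=
        Φ.le_opNorm_of_le (ContinuousLinearMap.opNorm_comp_le _ _)
    _ ≤ ‖Φ‖ * (‖φ‖ * ‖a‖) := by
        gcongr
        exact ContinuousLinearMap.opNorm_mul_apply_le ℂ A a
    _ = ‖Φ‖ * ‖φ‖ * ‖a‖ := (mul_assoc _ _ _).symm

theorem bidual_norm_mul_le (Φ Ψ : StrongDual ℂ (StrongDual ℂ A)) :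
    ‖(bidual A).mul Φ Ψ‖ ≤ ‖Φ‖ * ‖Ψ‖ := by
  refine ContinuousLinearMap.opNorm_le_bound _ (by positivity) fun φ => ?_
  rw [mul_assoc]
  exact Φ.le_opNorm_of_le (norm_arensAct_le Ψ φ)

theorem norm_dualStar_le (φ : StrongDual ℂ A) : ‖dualStar φ‖ ≤ ‖φ‖ := by
  refine ContinuousLinearMap.opNorm_le_bound _ (norm_nonneg _) fun a => ?_
  rw [dualStar_apply, norm_star, ← norm_star a]
  exact φ.le_opNorm _

theorem bidual_norm_star_le (Φ : StrongDual ℂ (StrongDual ℂ A)) :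
    ‖(bidual A).star Φ‖ ≤ ‖Φ‖ := by
  refine ContinuousLinearMap.opNorm_le_bound _ (by positivity) fun φ => ?_
  rw [bidual_star_apply, norm_star]
  exact Φ.le_opNorm_of_le (norm_dualStar_le φ)

theorem bidual_norm_star_mul_self (Φ : StrongDual ℂ (StrongDual ℂ A)) :
    ‖(bidual A).mul ((bidual A).star Φ) Φ‖ = ‖Φ‖ * ‖Φ‖ := by
  let := CStarAlgebra.spectralOrder A
  let := CStarAlgebra.spectralOrderedRing A
  refine le_antisymm ((bidual_norm_mul_le _ _).trans ?_) ?_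
  · gcongr
    exact bidual_norm_star_le Φ
  set Θ := (bidual A).mul ((bidual A).star Φ) Φ with hΘ
  suffices hle : ‖Φ‖ ≤ √‖Θ‖ from
    (mul_self_le_mul_self (norm_nonneg Φ) hle).trans_eq (Real.mul_self_sqrt (norm_nonneg Θ))
  refine ContinuousLinearMap.opNorm_le_bound _ (Real.sqrt_nonneg _) fun φ => ?_
  obtain ⟨ω, hω, η, hη_norm, hη⟩ := exists_quasiState_gns_vector φ
  set Λ := gnsEmbed (toPositiveLinearMap ω hω.2)
  have hω_inner (a b : A) : ω (a * b) = ⟪Λ (star a), Λ b⟫_ℂ := by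
    rw [inner_gnsEmbed, star_star]
    rfl
  have hΘω : Θ ω = (‖bidualExtend Λ Φ‖ : ℂ) ^ 2 := by
    rw [hΘ, bidual_mul_apply_eq_inner hω_inner, bidual_star_star]
    exact inner_self_eq_norm_sq_to_K _
  have hΛΦ : ‖bidualExtend Λ Φ‖ ^ 2 ≤ ‖Θ‖ := by
    have hle := Θ.le_opNorm_of_le hω.1
    rwa [hΘω, norm_pow, Complex.norm_real, norm_norm, mul_one] at hle
  have hΦφ : Φ φ = ⟪η, bidualExtend Λ Φ⟫_ℂ := by
    rw [inner_bidualExtend]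
    congr 1
    ext b
    exact hη b
  calc ‖Φ φ‖ ≤ ‖η‖ * ‖bidualExtend Λ Φ‖ := hΦφ ▸ norm_inner_le_norm _ _
    _ ≤ ‖φ‖ * √‖Θ‖ := by gcongr; exact Real.le_sqrt_of_sq_le hΛΦ
    _ = √‖Θ‖ * ‖φ‖ := mul_comm _ _

end Arens

/-! ### The weak-* topology -/

section WeakStar

variable {E F : Type*} [NormedAddCommGroup E] [NormedSpace ℂ E]
  [NormedAddCommGroup F] [NormedSpace ℂ F]

theorem exists_ultralimit {ι : Type*} (𝒰 : Ultrafilter ι) (x : ι → StrongDual ℂ E) (C : ℝ)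
    (hx : ∀ᶠ i in 𝒰, ‖x i‖ ≤ C) :
    ∃ y : StrongDual ℂ E, ‖y‖ ≤ C ∧ ∀ φ, Tendsto (fun i => x i φ) 𝒰 (𝓝 (y φ)) := by
  have hc := WeakDual.isCompact_closedBall (𝕜 := ℂ) (0 : StrongDual ℂ E) C
  obtain ⟨y, hy, hle⟩ := hc.ultrafilter_le_nhds (𝒰.map fun i => StrongDual.toWeakDual (x i)) (by
    rw [le_principal_iff, Ultrafilter.coe_map, mem_map]
    filter_upwards [hx] with i hi
    exact mem_closedBall_zero_iff.2 hi)
  refine ⟨WeakDual.toStrongDual y, mem_closedBall_zero_iff.1 hy, fun φ => ?_⟩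
  exact ((WeakDual.eval_continuous φ).tendsto y).comp hle

theorem continuous_wstar_iff {X : Type*} (τ : TopologicalSpace X) (f : X → StrongDual ℂ E) :
    Continuous[τ, wstar E] f ↔ ∀ φ, Continuous[τ, _] fun x => f x φ := by
  rw [continuous_induced_rng]
  exact ⟨fun h φ => (WeakDual.eval_continuous φ).comp h, WeakDual.continuous_of_continuous_eval⟩

theorem continuous_wstar_eval (φ : E) :
    Continuous[wstar E, _] fun x : StrongDual ℂ E => x φ :=
  (continuous_wstar_iff (wstar E) id).1 (@continuous_id _ (wstar E)) φ

theorem continuous_wstar_bidualMap (f : E →L[ℂ] F) :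
    Continuous[wstar (StrongDual ℂ E), wstar (StrongDual ℂ F)] (bidualMap f) :=
  (continuous_wstar_iff _ _).2 fun φ => continuous_wstar_eval (φ.comp f)

theorem isClosed_wstar_eval_eq_zero (φ : E) :
    IsClosed[wstar E] {x : StrongDual ℂ E | x φ = 0} := by
  let := wstar E
  exact isClosed_eq (continuous_wstar_eval φ) continuous_const

theorem eval_eq_zero_of_re_lt {W : Submodule ℂ (StrongDual ℂ E)} {φ : E} {c : ℝ}
    (h : ∀ x ∈ W, (x φ).re < c) {x : StrongDual ℂ E} (hx : x ∈ W) : x φ = 0 := by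
  by_contra hne
  have hlt := h _ (W.smul_mem ((c : ℂ) * (x φ)⁻¹) hx)
  rw [smul_apply, smul_eq_mul, inv_mul_cancel_right₀ hne, Complex.ofReal_re] at hlt
  exact lt_irrefl c hlt

theorem wstar_closure_eq_univ (W : Submodule ℂ (StrongDual ℂ E))
    (hW : ∀ φ : E, (∀ x ∈ W, x φ = 0) → φ = 0) :
    @closure _ (wstar E) (W : Set (StrongDual ℂ E)) = Set.univ := by
  let W' : Submodule ℂ (WeakDual ℂ E) := W.map StrongDual.toWeakDual.toLinearMap
  let := wstar E
  have hind : Topology.IsInducing fun x : StrongDual ℂ E => StrongDual.toWeakDual x := ⟨rfl⟩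
  rw [hind.closure_eq_preimage_closure_image, Set.eq_univ_iff_forall]
  intro x
  change StrongDual.toWeakDual x ∈ W'.topologicalClosure
  by_contra hx
  have hconv : Convex ℝ (W'.topologicalClosure : Set (WeakDual ℂ E)) := fun a ha b hb s t _ _ _ =>
    W'.topologicalClosure.add_mem (W'.topologicalClosure.smul_mem (s : ℂ) ha)
      (W'.topologicalClosure.smul_mem (t : ℂ) hb)
  obtain ⟨φ, c, hlt, hc⟩ := exists_eval_separating hconv W'.isClosed_topologicalClosure hx
  have hφ : φ = 0 := hW φ fun y hy =>
    eval_eq_zero_of_re_lt (fun z hz => hlt _ (W'.le_topologicalClosure ⟨z, hz, rfl⟩)) hy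
  have hc_pos := hlt 0 W'.topologicalClosure.zero_mem
  rw [hφ, map_zero, Complex.zero_re] at hc hc_pos
  exact lt_asymm hc hc_pos

theorem wstar_closure_span_eq_univ_iff (s : Set (StrongDual ℂ E)) :
    @closure _ (wstar E) (Submodule.span ℂ s : Set (StrongDual ℂ E)) = Set.univ ↔
      ∀ φ : E, (∀ x ∈ s, x φ = 0) → φ = 0 := by
  let := wstar E
  refine ⟨fun hs φ hφ => ?_, fun hs => wstar_closure_eq_univ _ fun φ hφ =>
    hs φ fun x hx => hφ x (Submodule.subset_span hx)⟩
  have hspan : Submodule.span ℂ s ≤ LinearMap.ker ((topDualPairing ℂ E).flip φ) :=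
    Submodule.span_le.2 hφ
  have hclosure := closure_minimal hspan (isClosed_wstar_eval_eq_zero φ)
  rw [hs] at hclosure
  exact SeparatingDual.eq_zero_of_forall_dual_eq_zero (R := ℂ) fun x => hclosure (Set.mem_univ x)

/-- `p''` is the annihilator of the annihilator of `p`: a functional `x` on `E'` that vanishes on
`p^⊥` factors through the restriction `E' → p'`, whose Hahn-Banach lifts preserve the norm. -/
theorem mem_range_bidualMap_subtypeL_iff {p : Submodule ℂ E}
    {x : StrongDual ℂ (StrongDual ℂ E)} :
    x ∈ LinearMap.range (bidualMap p.subtypeL).toLinearMap ↔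
      ∀ φ : StrongDual ℂ E, (∀ a ∈ p, φ a = 0) → x φ = 0 := by
  constructor
  · rintro ⟨y, rfl⟩ φ hφ
    change y (φ.comp p.subtypeL) = 0
    rw [show φ.comp p.subtypeL = 0 from ContinuousLinearMap.ext fun a => hφ a a.2, map_zero]
  · intro hx
    let R : StrongDual ℂ E →ₗ[ℂ] StrongDual ℂ p :=
      (ContinuousLinearMap.precomp ℂ p.subtypeL).toLinearMap
    obtain ⟨y, hy⟩ : x.toLinearMap ∈ LinearMap.range R.dualMap := by
      rw [LinearMap.range_dualMap_eq_dualAnnihilator_ker, Submodule.mem_dualAnnihilator]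
      exact fun φ hφ => hx φ fun a ha => DFunLike.congr_fun (LinearMap.mem_ker.1 hφ) ⟨a, ha⟩
    have hyR (φ : StrongDual ℂ E) : y (R φ) = x φ := DFunLike.congr_fun hy φ
    have hy_bound (φ : StrongDual ℂ p) : ‖y φ‖ ≤ ‖x‖ * ‖φ‖ := by
      obtain ⟨g, hg, hg_norm⟩ := exists_extension_norm_eq p φ
      rw [← hg_norm, ← show R g = φ from ContinuousLinearMap.ext hg, hyR]
      exact x.le_opNorm g
    refine ⟨y.mkContinuous ‖x‖ hy_bound, ?_⟩
    ext φ
    exact hyR φ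

theorem isEmbedding_bidualMap_subtypeL (p : Submodule ℂ E) :
    @Topology.IsEmbedding _ _ (wstar (StrongDual ℂ p)) (wstar (StrongDual ℂ E))
      (bidualMap p.subtypeL) := by
  let := wstar (StrongDual ℂ p)
  let := wstar (StrongDual ℂ E)
  refine ⟨⟨le_antisymm (continuous_wstar_bidualMap _).le_induced ?_⟩,
    bidualMap_subtypeL_injective p⟩
  rw [← continuous_id_iff_le]
  refine (continuous_wstar_iff _ _).2 fun φ => ?_
  obtain ⟨g, hg, -⟩ := exists_extension_norm_eq p φ
  rw [← show g.comp p.subtypeL = φ from ContinuousLinearMap.ext hg]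
  exact @Continuous.comp _ _ _ (TopologicalSpace.induced (bidualMap p.subtypeL) _)
    (wstar (StrongDual ℂ E)) _ _ _ (continuous_wstar_eval g) continuous_induced_dom

end WeakStar

/-! ### The bidual of a C*-algebra -/

section Bidual

variable {A : Type u} [NonUnitalCStarAlgebra A]

theorem bidual_mul_assoc (x y z : StrongDual ℂ (StrongDual ℂ A)) :
    (bidual A).mul ((bidual A).mul x y) z = (bidual A).mul x ((bidual A).mul y z) := by
  ext φ
  simp only [bidual_mul_apply]
  congr 1
  ext a
  simp only [arensAct_apply, bidual_mul_apply]
  congr 1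
  ext b
  simp only [arensAct_apply, ContinuousLinearMap.comp_apply, ContinuousLinearMap.mul_apply']
  congr 1
  ext c
  simp [mul_assoc]

theorem arensAct_add (x y : StrongDual ℂ (StrongDual ℂ A)) (φ : StrongDual ℂ A) :
    arensAct (x + y) φ = arensAct x φ + arensAct y φ := rfl

theorem arensAct_smul (c : ℂ) (x : StrongDual ℂ (StrongDual ℂ A)) (φ : StrongDual ℂ A) :
    arensAct (c • x) φ = c • arensAct x φ := rfl

theorem exists_bidual_right_one (A : Type u) [NonUnitalCStarAlgebra A] :
    ∃ e, ∀ x, (bidual A).mul x e = x := by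
  let := CStarAlgebra.spectralOrder A
  let := CStarAlgebra.spectralOrderedRing A
  have hl := CStarAlgebra.increasingApproximateUnit A
  let 𝒰 : Ultrafilter A := Ultrafilter.of (CStarAlgebra.approximateUnit A)
  have h𝒰 : (𝒰 : Filter A) ≤ CStarAlgebra.approximateUnit A := Ultrafilter.of_le _
  obtain ⟨e, -, he⟩ := exists_ultralimit 𝒰
    (fun a => NormedSpace.inclusionInDoubleDual ℂ A a) 1 (by
      filter_upwards [h𝒰 hl.eventually_norm] with a ha
      exact (NormedSpace.double_dual_bound ℂ A a).trans ha)
  refine ⟨e, fun x => ContinuousLinearMap.ext fun φ => ?_⟩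
  rw [bidual_mul_apply]
  congr 1
  ext a
  rw [arensAct_apply]
  exact tendsto_nhds_unique (he _)
    ((φ.continuous.tendsto a).comp ((hl.tendsto_mul_left a).mono_left h𝒰))

theorem exists_bidual_one (A : Type u) [NonUnitalCStarAlgebra A] :
    ∃ e, ∀ x, (bidual A).mul e x = x ∧ (bidual A).mul x e = x := by
  obtain ⟨e, he⟩ := exists_bidual_right_one A
  have he_star (x) : (bidual A).mul ((bidual A).star e) x = x := by
    have := congrArg (bidual A).star (he ((bidual A).star x))
    rwa [bidual_star_mul, bidual_star_star] at this
  have hstar : (bidual A).star e = e := (he _).symm.trans (he_star e)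
  rw [hstar] at he_star
  exact ⟨e, fun x => ⟨he_star x, he x⟩⟩

theorem bidual_isWStarAlgebra (A : Type u) [NonUnitalCStarAlgebra A] :
    (bidual A).IsWStarAlgebra where
  complete := inferInstance
  mul_assoc := bidual_mul_assoc
  add_mul _ _ _ := rfl
  mul_add x y z := by
    ext φ
    change x (arensAct (y + z) φ) = _
    rw [arensAct_add, map_add]
    rfl
  smul_mul _ _ _ := rfl
  mul_smul c x y := by
    ext φ
    change x (arensAct (c • y) φ) = _
    rw [arensAct_smul, map_smul]
    rfl
  exists_one := exists_bidual_one A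
  star_star := bidual_star_star
  star_add x y := by
    ext φ
    simp only [bidual_star_apply, add_apply, star_add]
  star_smul c x := by
    ext φ
    simp only [bidual_star_apply, smul_apply, star_smul]
    rfl
  star_mul := bidual_star_mul
  norm_mul_le := bidual_norm_mul_le
  norm_star_mul_self := bidual_norm_star_mul_self

variable {B : Type w} [NonUnitalCStarAlgebra B]

theorem bidualMap_mul (f : A →L[ℂ] B) (hf : ∀ a b, f (a * b) = f a * f b)
    (x y : StrongDual ℂ (StrongDual ℂ A)) :
    bidualMap f ((bidual A).mul x y) = (bidual B).mul (bidualMap f x) (bidualMap f y) := by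
  ext φ
  rw [bidualMap_apply, bidual_mul_apply, bidual_mul_apply, bidualMap_apply]
  congr 1
  ext a
  simp only [arensAct_apply, bidualMap_apply, ContinuousLinearMap.comp_apply]
  congr 1
  ext b
  simp [hf]

theorem bidualMap_star (f : A →L[ℂ] B) (hf : ∀ a, f (star a) = star (f a))
    (x : StrongDual ℂ (StrongDual ℂ A)) :
    bidualMap f ((bidual A).star x) = (bidual B).star (bidualMap f x) := by
  ext φ
  rw [bidualMap_apply, bidual_star_apply, bidual_star_apply, bidualMap_apply]
  congr 2
  ext a
  simp [dualStar_apply, hf]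

end Bidual

namespace CStarIdeal

variable {A : Type u} [NonUnitalCStarAlgebra A] (J : CStarIdeal A)

theorem mem_bidualRange_iff {x : StrongDual ℂ (StrongDual ℂ A)} :
    x ∈ J.bidualRange ↔ ∀ φ : StrongDual ℂ A, (∀ a ∈ J.alg, φ a = 0) → x φ = 0 :=
  mem_range_bidualMap_subtypeL_iff (p := J.alg.toSubmodule)

theorem bidualIncl_mul (x y : StrongDual ℂ (StrongDual ℂ J.alg)) :
    J.bidualIncl ((_root_.bidual J.alg).mul x y) =
      (_root_.bidual A).mul (J.bidualIncl x) (J.bidualIncl y) :=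
  bidualMap_mul J.incl (fun _ _ => rfl) x y

theorem bidualIncl_star (x : StrongDual ℂ (StrongDual ℂ J.alg)) :
    J.bidualIncl ((_root_.bidual J.alg).star x) = (_root_.bidual A).star (J.bidualIncl x) :=
  bidualMap_star J.incl (fun _ => rfl) x

theorem isEmbedding_bidualIncl :
    @Topology.IsEmbedding _ _ (wstar (StrongDual ℂ J.alg)) (wstar (StrongDual ℂ A))
      J.bidualIncl :=
  isEmbedding_bidualMap_subtypeL J.alg.toSubmodule

theorem isClosed_bidualRange :
    IsClosed[wstar (StrongDual ℂ A)] (J.bidualRange : Set (StrongDual ℂ (StrongDual ℂ A))) := by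
  have hinter : (J.bidualRange : Set (StrongDual ℂ (StrongDual ℂ A))) =
      ⋂ (φ : StrongDual ℂ A) (_ : ∀ a ∈ J.alg, φ a = 0), {x | x φ = 0} := by
    ext x
    simp only [SetLike.mem_coe, mem_bidualRange_iff, Set.mem_iInter]
    rfl
  rw [hinter]
  let := wstar (StrongDual ℂ A)
  exact isClosed_iInter fun φ => isClosed_iInter fun _ => isClosed_wstar_eval_eq_zero φ

theorem isWStarIdeal_bidualRange : (_root_.bidual A).IsWStarIdeal J.bidualRange where
  mul_mem_left a x hx := by
    rw [mem_bidualRange_iff] at hx ⊢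
    intro φ hφ
    have hact : arensAct x φ = 0 := by
      ext b
      exact hx _ fun c hc => hφ _ (J.mul_mem_left b c hc)
    rw [bidual_mul_apply, hact, map_zero]
  mul_mem_right a x hx := by
    rw [mem_bidualRange_iff] at hx ⊢
    intro φ hφ
    refine hx _ fun b hb => ?_
    have hcomp : φ.comp (ContinuousLinearMap.mul ℂ A b) = 0 := by
      ext c
      exact hφ _ (J.mul_mem_right c b hb)
    change a (φ.comp (ContinuousLinearMap.mul ℂ A b)) = 0
    rw [hcomp, map_zero]
  star_mem := by
    rintro _ ⟨y, rfl⟩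
    exact ⟨_, J.bidualIncl_star y⟩
  isClosed := J.isClosed_bidualRange

/-- The functionals `a ↦ φ(a b)` with `b ∈ J` vanish on `I`, and multiplication by the unit of
`J''` fixes `x`, so `x` cannot see the values of `φ` outside `I ∩ J`. -/
theorem apply_eq_zero_of_mem_bidualRange (I J : CStarIdeal A)
    {x : StrongDual ℂ (StrongDual ℂ A)} (hI : x ∈ I.bidualRange) (hJ : x ∈ J.bidualRange)
    (φ : StrongDual ℂ A) (hφ : ∀ a ∈ I.alg, a ∈ J.alg → φ a = 0) : x φ = 0 := by
  obtain ⟨e, he⟩ := exists_bidual_one J.alg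
  have hx : (_root_.bidual A).mul x (J.bidualIncl e) = x := by
    obtain ⟨y, rfl⟩ := hJ
    rw [← bidualIncl_mul, (he y).2]
  have heJ : J.bidualIncl e ∈ J.bidualRange := ⟨e, rfl⟩
  rw [mem_bidualRange_iff] at hI heJ
  rw [← hx, bidual_mul_apply]
  refine hI _ fun a ha => ?_
  rw [arensAct_apply]
  exact heJ _ fun b hb => hφ _ (I.mul_mem_right b a ha) (J.mul_mem_left a b hb)

end CStarIdeal

/-! ### Restrictions of global actions -/

section Restriction

variable {G : Type v} [Group G] {E : Type u} [NormedAddCommGroup E] [NormedSpace ℂ E]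
  {F : Type w} [NormedAddCommGroup F] [NormedSpace ℂ F]
  {M : DualStarAlgebra E} {γ : PartialFamily G (StrongDual ℂ E)} {N : DualStarAlgebra F}
  {σ : G → StrongDual ℂ F →ₗ[ℂ] StrongDual ℂ F} {ι : StrongDual ℂ E →ₗ[ℂ] StrongDual ℂ F}

namespace IsWStarAction

theorem act_act_inv (hσ : IsWStarAction N σ) (t : G) (x : StrongDual ℂ F) :
    σ t (σ t⁻¹ x) = x := by
  rw [← hσ.act_mul, mul_inv_cancel, hσ.act_one]

theorem act_inv_act (hσ : IsWStarAction N σ) (t : G) (x : StrongDual ℂ F) :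
    σ t⁻¹ (σ t x) = x := by
  rw [← hσ.act_mul, inv_mul_cancel, hσ.act_one]

theorem injective (hσ : IsWStarAction N σ) (t : G) : Function.Injective (σ t) :=
  Function.LeftInverse.injective (hσ.act_inv_act t)

theorem mem_dom_inv_iff (hσ : IsWStarAction N σ) (hι : Function.Injective ι)
    (map_dom : ∀ t, ι '' (γ.dom t) = Set.range ι ∩ σ t '' Set.range ι) {t : G}
    {x : StrongDual ℂ E} : x ∈ γ.dom t⁻¹ ↔ ∃ y, ι y = σ t (ι x) := by
  rw [← SetLike.mem_coe, ← hι.mem_set_image, map_dom]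
  constructor
  · rintro ⟨-, -, ⟨y, rfl⟩, hy⟩
    exact ⟨y, by rw [← hy, hσ.act_act_inv]⟩
  · rintro ⟨y, hy⟩
    exact ⟨⟨x, rfl⟩, ι y, ⟨y, rfl⟩, by rw [hy, hσ.act_inv_act]⟩

theorem bijective_act (hσ : IsWStarAction N σ) (hι : Function.Injective ι)
    (map_dom : ∀ t, ι '' (γ.dom t) = Set.range ι ∩ σ t '' Set.range ι)
    (map_act : ∀ (t : G) (x : γ.dom t⁻¹), ι (γ.act t x) = σ t (ι x)) (t : G) :
    Function.Bijective (γ.act t) := by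
  refine ⟨fun x y hxy => Subtype.ext (hι (hσ.injective t ?_)), fun y => ?_⟩
  · rw [← map_act, ← map_act, hxy]
  · obtain ⟨-, -, ⟨x, rfl⟩, hx⟩ := (map_dom t).subset ⟨y, y.2, rfl⟩
    refine ⟨⟨x, (hσ.mem_dom_inv_iff hι map_dom).2 ⟨y, hx.symm⟩⟩, Subtype.ext (hι ?_)⟩
    rw [map_act, hx]

end IsWStarAction

theorem IsWStarPartialAction.of_embedding (hM : M.IsWStarAlgebra)
    (hγ : ∀ t, M.IsWStarIdeal (γ.dom t)) (hσ : IsWStarAction N σ)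
    (map_mul : ∀ x y, ι (M.mul x y) = N.mul (ι x) (ι y))
    (map_star : ∀ x, ι (M.star x) = N.star (ι x))
    (hι : @Topology.IsEmbedding _ _ (wstar E) (wstar F) ι)
    (map_dom : ∀ t, ι '' (γ.dom t) = Set.range ι ∩ σ t '' Set.range ι)
    (map_act : ∀ (t : G) (x : γ.dom t⁻¹), ι (γ.act t x) = σ t (ι x)) :
    IsWStarPartialAction M γ := by
  let := wstar E
  let := wstar F
  have mem_dom_inv_iff {t : G} {x : StrongDual ℂ E} := hσ.mem_dom_inv_iff (t := t) (x := x)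
    hι.injective map_dom
  exact
    { isWStarAlgebra := hM
      ideal := hγ
      bijective := hσ.bijective_act hι.injective map_dom map_act
      map_mul := fun t x y z hz => hι.injective <| by
        rw [map_act, hz, map_mul, hσ.map_mul, map_mul, map_act, map_act]
      map_star := fun t x z hz => hι.injective <| by
        rw [map_act, hz, map_star, hσ.map_star, map_star, map_act]
      wstar_continuous := fun t => by
        refine hι.isInducing.continuous_iff.2 ?_
        have hcomp : (ι ∘ fun x : γ.dom t⁻¹ => (γ.act t x : StrongDual ℂ E)) =
            fun x : γ.dom t⁻¹ => σ t (ι x) := funext (map_act t)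
        rw [hcomp]
        exact (hσ.wstar_continuous t).comp (hι.continuous.comp continuous_induced_dom)
      dom_one := eq_top_iff.2 fun x _ =>
        inv_one (G := G) ▸ mem_dom_inv_iff.2 ⟨x, (hσ.act_one _).symm⟩
      act_one := fun x => hι.injective <| by rw [map_act, hσ.act_one]
      act_mul := fun s t x h => by
        obtain ⟨y, hy⟩ := mem_dom_inv_iff.1 h
        have hx : (x : StrongDual ℂ E) ∈ γ.dom (s * t)⁻¹ :=
          mem_dom_inv_iff.2 ⟨y, by rw [hy, map_act, hσ.act_mul]⟩
        exact ⟨hx, hι.injective (by rw [map_act, map_act, map_act, hσ.act_mul])⟩ }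

end Restriction

section BidualAction

variable {A : Type u} [NonUnitalCStarAlgebra A] {G : Type v} [Group G]

theorem bidualAction_isWStarAction (β : G →* (A ≃⋆ₐ[ℂ] A)) :
    IsWStarAction (bidual A) (bidualAction β) where
  isWStarAlgebra := bidual_isWStarAlgebra A
  map_mul t := bidualMap_mul (starIsoL (β t)) (map_mul (β t))
  map_star t := bidualMap_star (starIsoL (β t)) (map_star (β t))
  wstar_continuous t := continuous_wstar_bidualMap (starIsoL (β t))
  act_one x := by
    have hone : starIsoL (β 1) = ContinuousLinearMap.id ℂ A := by ext a; simp [starIsoL]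
    change bidualMap (starIsoL (β 1)) x = x
    rw [hone]
    rfl
  act_mul s t x := by
    have hmul : starIsoL (β (s * t)) = (starIsoL (β s)).comp (starIsoL (β t)) := by
      ext a; simp [starIsoL]
    change bidualMap (starIsoL (β (s * t))) x = _
    rw [hmul]
    rfl

theorem CStarPartialAction.bidual_act_bidualIncl (α : CStarPartialAction G A) (t : G)
    (x : α.bidual.dom t⁻¹) (y : StrongDual ℂ (StrongDual ℂ (α.dom t⁻¹).alg))
    (hy : (α.dom t⁻¹).bidualIncl y = x) :
    (α.bidual.act t x : StrongDual ℂ (StrongDual ℂ A)) =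
      (α.dom t).bidualIncl (bidualMap (starIsoL (α.act t)) y) := by
  have hsymm : (α.dom t⁻¹).bidualEquiv.symm x = y :=
    (LinearEquiv.symm_apply_eq (α.dom t⁻¹).bidualEquiv).2 (Subtype.ext hy.symm)
  exact congrArg (fun z => (α.dom t).bidualIncl (bidualMap (starIsoL (α.act t)) z)) hsymm

end BidualAction

section BidualRestriction

variable {B : Type u} [NonUnitalCStarAlgebra B] {G : Type v} [Group G]
  (β : G →* (B ≃⋆ₐ[ℂ] B)) (A : CStarIdeal B)

/-- The ideal `β_t(A)` of `B`. -/
def translateIdeal (t : G) : CStarIdeal B where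
  alg := A.alg.comap (β t⁻¹ : B →⋆ₙₐ[ℂ] B)
  isClosed := A.isClosed.preimage (StarAlgEquiv.isometry (β t⁻¹)).continuous
  mul_mem_left a x hx := by
    change β t⁻¹ (a * x) ∈ A.alg
    rw [map_mul]
    exact A.mul_mem_left _ _ hx
  mul_mem_right a x hx := by
    change β t⁻¹ (x * a) ∈ A.alg
    rw [map_mul]
    exact A.mul_mem_right _ _ hx

theorem bidualAction_bidualIncl_mem_translateIdeal (t : G)
    (x : StrongDual ℂ (StrongDual ℂ A.alg)) :
    bidualAction β t (A.bidualIncl x) ∈ (translateIdeal β A t).bidualRange := by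
  rw [CStarIdeal.mem_bidualRange_iff]
  intro ψ hψ
  have hcomp : (ψ.comp (starIsoL (β t))).comp A.incl = 0 := by
    ext a
    refine hψ _ ?_
    change β t⁻¹ (β t (a : B)) ∈ A.alg
    rw [act_inv_apply]
    exact a.2
  change x ((ψ.comp (starIsoL (β t))).comp A.incl) = 0
  rw [hcomp, map_zero]

theorem mem_bidualRange_restrictDom {t : G} {x : StrongDual ℂ (StrongDual ℂ A.alg)}
    (hx : A.bidualIncl x ∈ (translateIdeal β A t).bidualRange) :
    x ∈ (restrictDom β A t).bidualRange := by
  refine (CStarIdeal.mem_bidualRange_iff _).2 fun φ hφ => ?_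
  obtain ⟨g, hg, -⟩ := exists_extension_norm_eq A.alg.toSubmodule φ
  obtain rfl : g.comp A.incl = φ := ContinuousLinearMap.ext hg
  exact A.apply_eq_zero_of_mem_bidualRange (translateIdeal β A t) ⟨x, rfl⟩ hx g
    fun a ha hat => hφ ⟨a, ha⟩ hat

theorem bidualIncl_image_restrictDom (t : G) :
    A.bidualIncl '' (restrictDom β A t).bidualRange =
      Set.range A.bidualIncl ∩ bidualAction β t '' Set.range A.bidualIncl := by
  refine Set.Subset.antisymm ?_ ?_
  · rintro _ ⟨_, ⟨y, rfl⟩, rfl⟩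
    refine ⟨⟨_, rfl⟩, _, ⟨(restrictDom β A t⁻¹).bidualIncl
      (bidualMap (starIsoL (restrictAct β A t).symm) y), rfl⟩, ?_⟩
    change bidualMap (((starIsoL (β t)).comp (A.incl.comp (restrictDom β A t⁻¹).incl)).comp
      (starIsoL (restrictAct β A t).symm)) y = bidualMap (A.incl.comp (restrictDom β A t).incl) y
    congr 2
    ext x
    exact act_apply_inv β t _
  · rintro _ ⟨⟨x, rfl⟩, _, ⟨w, rfl⟩, hw⟩
    exact ⟨x, mem_bidualRange_restrictDom β A
      (hw ▸ bidualAction_bidualIncl_mem_translateIdeal β A t w), rfl⟩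

theorem bidualIncl_restrictAction_bidual_act (t : G)
    (x : (restrictAction β A).bidual.dom t⁻¹) :
    A.bidualIncl ((restrictAction β A).bidual.act t x) = bidualAction β t (A.bidualIncl x) := by
  obtain ⟨_, y, rfl⟩ := x
  exact congrArg A.bidualIncl
    ((restrictAction β A).bidual_act_bidualIncl t ⟨_, y, rfl⟩ y rfl)

theorem IsCStarEnveloping.closure_span_bidual (hA : IsCStarEnveloping β A) :
    @closure _ (wstar (StrongDual ℂ B)) (Submodule.span ℂ
      (⋃ t : G, bidualAction β t '' Set.range A.bidualIncl) :
        Set (StrongDual ℂ (StrongDual ℂ B))) = Set.univ := by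
  refine (wstar_closure_span_eq_univ_iff _).2 fun φ hφ => ?_
  have hspan : Submodule.span ℂ (⋃ t : G, β t '' (A.alg : Set B)) ≤
      LinearMap.ker φ.toLinearMap := by
    rw [Submodule.span_le]
    intro b hb
    obtain ⟨t, a, ha, rfl⟩ := Set.mem_iUnion.1 hb
    exact hφ (bidualAction β t (A.bidualIncl
      (NormedSpace.inclusionInDoubleDual ℂ A.alg ⟨a, ha⟩)))
      (Set.mem_iUnion.2 ⟨t, _, ⟨_, rfl⟩, rfl⟩)
  have hclosure := closure_minimal hspan φ.isClosed_ker
  rw [show closure _ = Set.univ from hA] at hclosure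
  ext b
  exact hclosure (Set.mem_univ b)

theorem isWStarEnveloping_bidual (hA : IsCStarEnveloping β A) :
    IsWStarEnveloping (bidual A.alg) (restrictAction β A).bidual
      (bidual B) (bidualAction β) A.bidualIncl where
  isWStarPartialAction := .of_embedding (bidual_isWStarAlgebra A.alg)
    (fun t => (restrictDom β A t).isWStarIdeal_bidualRange) (bidualAction_isWStarAction β)
    A.bidualIncl_mul A.bidualIncl_star A.isEmbedding_bidualIncl
    (bidualIncl_image_restrictDom β A) (bidualIncl_restrictAction_bidual_act β A)
  isWStarAction := bidualAction_isWStarAction β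
  ideal := A.isWStarIdeal_bidualRange
  map_mul := A.bidualIncl_mul
  map_star := A.bidualIncl_star
  wstar_embedding := A.isEmbedding_bidualIncl
  map_dom := bidualIncl_image_restrictDom β A
  map_act := bidualIncl_restrictAction_bidual_act β A
  dense := hA.closure_span_bidual

end BidualRestriction

/-! ### M-projections on dual Banach spaces -/

section Predual

variable {X : Type*} [NormedAddCommGroup X] [NormedSpace ℂ X]
  {F : Type*} [NormedAddCommGroup F] [NormedSpace ℂ F] (e : X ≃ₗᵢ[ℂ] StrongDual ℂ F)
  {ι : Type*} {𝒰 : Ultrafilter ι}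

theorem exists_predual_ultralimit (𝒰 : Ultrafilter ι) (x : ι → X) (C : ℝ)
    (hx : ∀ i, ‖x i‖ ≤ C) :
    ∃ y : X, ‖y‖ ≤ C ∧ ∀ φ, Tendsto (fun i => e (x i) φ) 𝒰 (𝓝 (e y φ)) := by
  obtain ⟨y, hy, hlim⟩ :=
    exists_ultralimit 𝒰 (fun i => e (x i)) C (.of_forall fun i => (e.norm_map _).trans_le (hx i))
  exact ⟨e.symm y, by simpa using hy, by simpa using hlim⟩

theorem ext_predual {x y : X} (h : ∀ φ, e x φ = e y φ) : x = y :=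
  e.injective (ContinuousLinearMap.ext h)

theorem norm_le_of_ultralimit {x : ι → X} {C : ℝ} {y : X} (hx : ∀ i, ‖x i‖ ≤ C)
    (hlim : ∀ φ, Tendsto (fun i => e (x i) φ) 𝒰 (𝓝 (e y φ))) : ‖y‖ ≤ C := by
  obtain ⟨z, hz, hz_lim⟩ := exists_predual_ultralimit e 𝒰 x C hx
  rwa [ext_predual e fun φ => tendsto_nhds_unique (hlim φ) (hz_lim φ)]

theorem exists_ultralimit_end (𝒰 : Ultrafilter ι) (T : ι → Module.End ℂ X)
    (hT : ∀ i x, ‖T i x‖ ≤ ‖x‖) :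
    ∃ P : Module.End ℂ X, ∀ x φ, Tendsto (fun i => e (T i x) φ) 𝒰 (𝓝 (e (P x) φ)) := by
  choose P _ hP using fun x =>
    exists_predual_ultralimit e 𝒰 (fun i => T i x) ‖x‖ fun i => hT i x
  refine ⟨{ toFun := P, map_add' := fun x y => ?_, map_smul' := fun c x => ?_ }, hP⟩
  · refine ext_predual e fun φ => tendsto_nhds_unique (hP _ φ) ?_
    simpa using (hP x φ).add (hP y φ)
  · refine ext_predual e fun φ => tendsto_nhds_unique (hP _ φ) ?_
    simpa using (hP x φ).const_mul c

/-- Split `f = g + (f - g)` with `g` a small Hahn-Banach extension of the restriction of `f` to the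
annihilator of `s`; then `f - g` lies in the span of `s`. -/
theorem exists_norm_sub_inclusionInDoubleDual_le {f : StrongDual ℂ (StrongDual ℂ F)} {ε : ℝ}
    (hε : 0 ≤ ε) (s : Finset F)
    (hf : ∀ y : StrongDual ℂ F, ‖y‖ ≤ 1 → (∀ φ ∈ s, y φ = 0) → ‖f y‖ ≤ ε) :
    ∃ ψ : F, ‖f - NormedSpace.inclusionInDoubleDual ℂ F ψ‖ ≤ ε := by
  let J : F →ₗ[ℂ] Module.Dual ℂ (StrongDual ℂ F) :=
    ContinuousLinearMap.coeLM ℂ ∘ₗ (NormedSpace.inclusionInDoubleDual ℂ F).toLinearMap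
  let W : Submodule ℂ (StrongDual ℂ F) := ⨅ φ : s, LinearMap.ker (J φ)
  have hW {y : StrongDual ℂ F} (hy : y ∈ W) (φ : F) (hφ : φ ∈ s) : y φ = 0 :=
    (Submodule.mem_iInf _).1 hy ⟨φ, hφ⟩
  obtain ⟨g, hg, hg_norm⟩ := exists_extension_norm_eq W (f.comp W.subtypeL)
  have hg_le : ‖g‖ ≤ ε := by
    rw [hg_norm]
    exact ContinuousLinearMap.opNorm_le_of_unit_norm hε fun y hy => hf y hy.le (hW y.2)
  have hspan : (f - g).toLinearMap ∈ Submodule.span ℂ (Set.range fun φ : s => J φ) :=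
    mem_span_of_iInf_ker_le_ker fun y hy => sub_eq_zero.2 (hg ⟨y, hy⟩).symm
  have hspan_le : Submodule.span ℂ (Set.range fun φ : s => J φ) ≤ LinearMap.range J :=
    Submodule.span_le.2 (Set.range_subset_iff.2 fun φ => ⟨φ, rfl⟩)
  obtain ⟨ψ, hψ⟩ := hspan_le hspan
  have hψ_eq : NormedSpace.inclusionInDoubleDual ℂ F ψ = f - g :=
    ContinuousLinearMap.coe_injective hψ
  exact ⟨ψ, by rw [hψ_eq, show f - (f - g) = g by abel]; exact hg_le⟩

theorem mem_range_inclusionInDoubleDual [CompleteSpace F] {f : StrongDual ℂ (StrongDual ℂ F)}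
    (hf : ∀ ε > 0, ∃ s : Finset F,
      ∀ y : StrongDual ℂ F, ‖y‖ ≤ 1 → (∀ φ ∈ s, y φ = 0) → ‖f y‖ ≤ ε) :
    f ∈ Set.range (NormedSpace.inclusionInDoubleDual ℂ F) := by
  let J : F →ₗᵢ[ℂ] StrongDual ℂ (StrongDual ℂ F) := NormedSpace.inclusionInDoubleDualLi ℂ
  change f ∈ Set.range J
  rw [← J.isometry.isClosedEmbedding.isClosed_range.closure_eq, Metric.mem_closure_iff]
  intro ε hε
  obtain ⟨s, hs⟩ := hf (ε / 2) (half_pos hε)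
  obtain ⟨ψ, hψ⟩ := exists_norm_sub_inclusionInDoubleDual_le (half_pos hε).le s hs
  exact ⟨_, ⟨ψ, rfl⟩, by rw [dist_eq_norm]; exact hψ.trans_lt (half_lt_self hε)⟩

end Predual

theorem eq_of_tendsto_ultrafilter_finset {T Y : Type*} [TopologicalSpace Y] [T2Space Y]
    {f : Finset T → Y} {a b : Y}
    (hf : Tendsto f (Ultrafilter.of atTop : Ultrafilter (Finset T)) (𝓝 a)) (t : T)
    (hfb : ∀ S, t ∈ S → f S = b) : a = b := by
  refine tendsto_nhds_unique hf (tendsto_const_nhds.congr' (Ultrafilter.of_le _ ?_))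
  filter_upwards [eventually_ge_atTop {t}] with S hS
  exact (hfb S (hS (Finset.mem_singleton_self t))).symm

section MProjection

variable {X : Type*} [NormedAddCommGroup X] [NormedSpace ℂ X]
  {F : Type*} [NormedAddCommGroup F] [NormedSpace ℂ F] {e : X ≃ₗᵢ[ℂ] StrongDual ℂ F}
  {P : Module.End ℂ X} {ι : Type*} {𝒰 : Ultrafilter ι}

theorem isMprojection_one_sub (hP : IsMprojection X P) : IsMprojection X (1 - P) :=
  ⟨hP.proj.one_sub, fun x => by rw [sub_sub_cancel, max_comm]; exact hP.Mnorm x⟩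

theorem norm_apply_le_of_isMprojection (hP : IsMprojection X P) (x : X) : ‖P x‖ ≤ ‖x‖ :=
  (le_max_left _ _).trans_eq (hP.Mnorm x).symm

theorem apply_apply_of_isMprojection (hP : IsMprojection X P) (x : X) : P (P x) = P x :=
  LinearMap.congr_fun hP.proj x

theorem norm_apply_add_sub_le_of_isMprojection (hP : IsMprojection X P) (x y : X) :
    ‖P x + (y - P y)‖ ≤ max ‖x‖ ‖y‖ := by
  have hPP := apply_apply_of_isMprojection hP
  have hsplit : ‖P x + (y - P y)‖ = max ‖P x‖ ‖y - P y‖ := by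
    rw [hP.Mnorm]
    simp [sub_smul, hPP]
  rw [hsplit]
  exact max_le_max (norm_apply_le_of_isMprojection hP x)
    (norm_apply_le_of_isMprojection (isMprojection_one_sub hP) y)

theorem isMprojection_of_norm_apply_add_sub_le (hP : ∀ x, P (P x) = P x)
    (hnorm : ∀ x y, ‖P x + (y - P y)‖ ≤ max ‖x‖ ‖y‖) : IsMprojection X P where
  proj := LinearMap.ext hP
  Mnorm x := by
    change ‖x‖ = max ‖P x‖ ‖x - P x‖
    refine le_antisymm ?_ (max_le ?_ ?_)
    · simpa [hP] using hnorm (P x) (x - P x)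
    · simpa using hnorm x 0
    · simpa using hnorm 0 x

/-- Otherwise `d = y - P y ≠ 0`, and `x i + c d` has norm at most `max C (c ‖d‖)` although its
limit `y + c d` has `(1 - P)`-component `(1 + c) d`; take `c = C / ‖d‖`. -/
theorem apply_eq_of_isMprojection_of_ultralimit (hP : IsMprojection X P) {x : ι → X} {C : ℝ}
    {y : X} (hx : ∀ i, ‖x i‖ ≤ C) (hPx : ∀ i, P (x i) = x i)
    (hlim : ∀ φ, Tendsto (fun i => e (x i) φ) 𝒰 (𝓝 (e y φ))) : P y = y := by
  by_contra hne
  set d := y - P y with hd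
  have hd_pos : 0 < ‖d‖ := norm_pos_iff.2 (sub_ne_zero.2 (Ne.symm hne))
  have hPd : P d = 0 := by rw [hd, map_sub, apply_apply_of_isMprojection hP, sub_self]
  have hC : 0 ≤ C := (norm_nonneg y).trans (norm_le_of_ultralimit e hx hlim)
  set c : ℝ := C / ‖d‖ with hc
  have hcd : ‖(c : ℂ) • d‖ = C := by
    rw [norm_smul, Complex.norm_of_nonneg (by positivity), div_mul_cancel₀ _ hd_pos.ne']
  have hle : ‖y + (c : ℂ) • d‖ ≤ C := by
    refine norm_le_of_ultralimit e (𝒰 := 𝒰) (x := fun i => x i + (c : ℂ) • d)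
      (fun i => ?_) fun φ => ?_
    · have := norm_apply_add_sub_le_of_isMprojection hP (x i) ((c : ℂ) • d)
      rwa [hPx, map_smul, hPd, smul_zero, sub_zero, hcd, max_eq_right (hx i)] at this
    · simpa using (hlim φ).add_const _
  have hcomp : (1 - P) (y + (c : ℂ) • d) = ((1 + c : ℝ) : ℂ) • d := by
    rw [LinearMap.sub_apply, Module.End.one_apply, map_add, map_smul, hPd, smul_zero, add_zero,
      add_sub_right_comm, ← hd]
    push_cast
    module
  have hcontr := norm_apply_le_of_isMprojection (isMprojection_one_sub hP) (y + (c : ℂ) • d)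
  rw [hcomp, norm_smul, Complex.norm_of_nonneg (by positivity), add_mul, one_mul, hc,
    div_mul_cancel₀ _ hd_pos.ne'] at hcontr
  linarith

theorem tendsto_apply_of_isMprojection (hP : IsMprojection X P) {x : ι → X} {C : ℝ}
    {y : X} (hx : ∀ i, ‖x i‖ ≤ C) (hlim : ∀ φ, Tendsto (fun i => e (x i) φ) 𝒰 (𝓝 (e y φ)))
    (φ : F) : Tendsto (fun i => e (P (x i)) φ) 𝒰 (𝓝 (e (P y) φ)) := by
  have hPP := apply_apply_of_isMprojection hP
  have hPc := isMprojection_one_sub hP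
  have hPx (i) : ‖P (x i)‖ ≤ C := (norm_apply_le_of_isMprojection hP _).trans (hx i)
  have hPcx (i) : ‖(1 - P) (x i)‖ ≤ C := (norm_apply_le_of_isMprojection hPc _).trans (hx i)
  obtain ⟨a, -, ha⟩ := exists_predual_ultralimit e 𝒰 _ C hPx
  obtain ⟨b, -, hb⟩ := exists_predual_ultralimit e 𝒰 _ C hPcx
  have hPa : P a = a := apply_eq_of_isMprojection_of_ultralimit hP hPx (fun i => hPP _) ha
  have hPb : P b = 0 := by
    have := apply_eq_of_isMprojection_of_ultralimit hPc hPcx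
      (fun i => apply_apply_of_isMprojection hPc _) hb
    simpa using this
  have hy : y = a + b := by
    refine ext_predual e fun φ => tendsto_nhds_unique (hlim φ) ?_
    simpa using (ha φ).add (hb φ)
  rw [hy, map_add, hPa, hPb, add_zero]
  exact ha φ

theorem exists_predual_of_isMprojection [CompleteSpace F] (hP : IsMprojection X P) (φ : F) :
    ∃ ψ : F, ∀ x, e (P x) φ = e x ψ := by
  let f : StrongDual ℂ (StrongDual ℂ F) := LinearMap.mkContinuous
    { toFun := fun y => e (P (e.symm y)) φ
      map_add' := fun y z => by simp
      map_smul' := fun c y => by simp } ‖φ‖ fun y => by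
        rw [mul_comm, ← e.symm.norm_map y]
        refine (e _).le_of_opNorm_le ?_ φ
        rw [e.norm_map]
        exact norm_apply_le_of_isMprojection hP _
  suffices hf : f ∈ Set.range (NormedSpace.inclusionInDoubleDual ℂ F) by
    obtain ⟨ψ, hψ⟩ := hf
    refine ⟨ψ, fun x => ?_⟩
    calc e (P x) φ = f (e x) := by simp [f]
      _ = e x ψ := by rw [← hψ]; rfl
  refine mem_range_inclusionInDoubleDual fun ε hε => ?_
  by_contra! hcon
  choose y hy_norm hy_zero hy_lt using hcon
  have hlim (ψ : F) : Tendsto (fun s => e (e.symm (y s)) ψ)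
      (Ultrafilter.of atTop : Ultrafilter (Finset F)) (𝓝 (e (0 : X) ψ)) := by
    refine tendsto_const_nhds.congr' (Ultrafilter.of_le _ ?_)
    filter_upwards [eventually_ge_atTop {ψ}] with s hs
    rw [e.apply_symm_apply, hy_zero s ψ (hs (Finset.mem_singleton_self ψ)), map_zero, zero_apply]
  have hf_lim : Tendsto (fun s => ‖f (y s)‖)
      (Ultrafilter.of atTop : Ultrafilter (Finset F)) (𝓝 0) := by
    have := (tendsto_apply_of_isMprojection hP
      (fun s => (e.symm.norm_map _).trans_le (hy_norm s)) hlim φ).norm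
    rwa [map_zero, map_zero, zero_apply, norm_zero] at this
  exact (ge_of_tendsto' hf_lim fun s => (hy_lt s).le).not_gt hε

end MProjection

/-! ### Gluing along central projections -/

/-- A projection in the centre of a *-algebra. The units of the ideals translated by an enveloping
action are of this form, and elements of the enveloping algebra are glued along them. -/
structure IsCentralProjection {R : Type*} [Mul R] [Star R] (p : R) : Prop
    extends IsStarProjection p where
  comm : ∀ x, Commute p x

namespace IsCentralProjection

section Ring

variable {R : Type*} [NonUnitalRing R] [StarRing R] {p q : R}

theorem mul_mul_self (hp : IsCentralProjection p) (x : R) : p * (p * x) = p * x := by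
  rw [← mul_assoc, hp.isIdempotentElem]

theorem mul_mul_mul_self (hp : IsCentralProjection p) (x y : R) :
    p * x * (p * y) = p * (x * y) := by
  rw [mul_assoc, ← mul_assoc x, ← (hp.comm x).eq, mul_assoc, hp.mul_mul_self]

theorem zero : IsCentralProjection (0 : R) := ⟨.zero R, Commute.zero_left⟩

theorem sup (hp : IsCentralProjection p) (hq : IsCentralProjection q) :
    IsCentralProjection (p + q - p * q) where
  toIsStarProjection :=
    hp.toIsStarProjection.add_sub_mul_of_commute (hp.comm q) hq.toIsStarProjection
  comm x := ((hp.comm x).add_left (hq.comm x)).sub_left ((hp.comm x).mul_left (hq.comm x))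

theorem exists_finset_sup {T : Type*} {p : T → R} (hp : ∀ t, IsCentralProjection (p t))
    (S : Finset T) :
    ∃ q, IsCentralProjection q ∧ (∀ t ∈ S, p t * q = p t) ∧
      ∀ z, (∀ t ∈ S, p t * z = 0) → q * z = 0 := by
  classical
  induction S using Finset.induction_on with
  | empty => exact ⟨0, .zero, by simp, by simp⟩
  | insert s S hs ih =>
    obtain ⟨q, hq, hpq, hq_zero⟩ := ih
    refine ⟨p s + q - p s * q, (hp s).sup hq, fun t ht => ?_, fun z hz => ?_⟩
    · rw [mul_sub, mul_add]
      rcases Finset.mem_insert.1 ht with rfl | ht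
      · rw [(hp t).mul_mul_self, (hp t).isIdempotentElem, add_sub_cancel_right]
      · rw [hpq t ht, (hp s).comm q, ← mul_assoc, hpq t ht, add_sub_cancel_left]
    · have hqz := hq_zero z fun t ht => hz t (Finset.mem_insert_of_mem ht)
      rw [sub_mul, add_mul, mul_assoc, hqz, hz s (Finset.mem_insert_self s S), mul_zero, add_zero,
        sub_zero]

end Ring

section CStar

variable {N : Type*} [NonUnitalCStarAlgebra N] {p : N}

/-- `(x, y) ↦ p x + (1 - p) y` is a *-homomorphism on `N × N`, hence contractive. -/
theorem isMprojection (hp : IsCentralProjection p) : IsMprojection N (LinearMap.mulLeft ℂ p) := by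
  have hcomm (x y : N) : x * (p * y) = p * (x * y) := by
    rw [← mul_assoc, ← (hp.comm x).eq, mul_assoc]
  let π : N × N →⋆ₙₐ[ℂ] N :=
    { toFun := fun z => p * z.1 + (z.2 - p * z.2)
      map_smul' := fun c z => by simp [smul_sub, mul_smul_comm]
      map_zero' := by simp
      map_add' := fun z w => by simp only [Prod.fst_add, Prod.snd_add, mul_add]; abel
      map_mul' := fun z w => by
        simp only [Prod.fst_mul, Prod.snd_mul, mul_add, add_mul, mul_sub, sub_mul, hp.mul_mul_self,
          hcomm, mul_assoc]
        abel
      map_star' := fun z => by simp [hp.isSelfAdjoint.star_eq, (hp.comm _).eq] }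
  exact isMprojection_of_norm_apply_add_sub_le hp.mul_mul_self
    fun x y => NonUnitalStarAlgHom.norm_apply_le π (x, y)

theorem norm_mul_le (hp : IsCentralProjection p) (x : N) : ‖p * x‖ ≤ ‖x‖ :=
  norm_apply_le_of_isMprojection hp.isMprojection x

variable {T : Type*} {p : T → N}

theorem exists_finset_glue (hp : ∀ t, IsCentralProjection (p t)) {g : T → N}
    (hg : ∀ t, p t * g t = g t) (hcompat : ∀ s t, p s * g t = p t * g s) {C : ℝ} (hC : 0 ≤ C)
    (hg_norm : ∀ t, ‖g t‖ ≤ C) (S : Finset T) : ∃ x, ‖x‖ ≤ C ∧ ∀ t ∈ S, p t * x = g t := by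
  classical
  induction S using Finset.induction_on with
  | empty => exact ⟨0, by simpa using hC, by simp⟩
  | insert s S hs ih =>
    obtain ⟨x, hx_norm, hx⟩ := ih
    refine ⟨g s + (x - p s * x), ?_, fun t ht => ?_⟩
    · have hnorm := norm_apply_add_sub_le_of_isMprojection (hp s).isMprojection (g s) x
      rw [LinearMap.mulLeft_apply, LinearMap.mulLeft_apply, hg] at hnorm
      exact hnorm.trans (max_le (hg_norm s) hx_norm)
    · rw [mul_add, mul_sub]
      rcases Finset.mem_insert.1 ht with rfl | ht
      · rw [hg, (hp t).mul_mul_self, sub_self, add_zero]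
      · rw [((hp s).comm x).eq, ← mul_assoc, hx t ht, ← ((hp s).comm _).eq, hcompat,
          add_sub_cancel]

variable {F : Type*} [NormedAddCommGroup F] [NormedSpace ℂ F]

theorem exists_glue (e : N ≃ₗᵢ[ℂ] StrongDual ℂ F) (hp : ∀ t, IsCentralProjection (p t))
    {g : T → N} (hg : ∀ t, p t * g t = g t) (hcompat : ∀ s t, p s * g t = p t * g s)
    {C : ℝ} (hC : 0 ≤ C)
    (hg_norm : ∀ t, ‖g t‖ ≤ C) : ∃ x, ‖x‖ ≤ C ∧ ∀ t, p t * x = g t := by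
  choose x hx_norm hx using exists_finset_glue hp hg hcompat hC hg_norm
  obtain ⟨y, hy_norm, hlim⟩ := exists_predual_ultralimit e (.of atTop) x C hx_norm
  refine ⟨y, hy_norm, fun t => ext_predual e fun φ => ?_⟩
  exact eq_of_tendsto_ultrafilter_finset
    (tendsto_apply_of_isMprojection (hp t).isMprojection hx_norm hlim φ) t
    fun S hS => congrArg (e · φ) (hx S t hS)

/-- `P` is the weak-* limit of the multiplications by the finite suprema of the `p t`. -/
theorem exists_isMprojection_sup (e : N ≃ₗᵢ[ℂ] StrongDual ℂ F)
    (hp : ∀ t, IsCentralProjection (p t)) :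
    ∃ P : Module.End ℂ N, IsMprojection N P ∧ (∀ t x, p t * x = x → P x = x) ∧
      ∀ x, (∀ t, p t * x = 0) → P x = 0 := by
  choose q hq hpq hq_zero using exists_finset_sup hp
  obtain ⟨P, hP⟩ := exists_ultralimit_end e (.of atTop) (fun S => LinearMap.mulLeft ℂ (q S))
    fun S => (hq S).norm_mul_le
  have hpP (t : T) (x : N) : p t * P x = p t * x := ext_predual e fun φ =>
    eq_of_tendsto_ultrafilter_finset
      (tendsto_apply_of_isMprojection (hp t).isMprojection (fun S => (hq S).norm_mul_le x)
        (hP x) φ) t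
      fun S hS => by simp only [LinearMap.mulLeft_apply, ← mul_assoc, hpq S t hS]
  have hqP (S : Finset T) (x : N) : q S * P x = q S * x := by
    rw [← sub_eq_zero, ← mul_sub]
    exact hq_zero S _ fun t _ => by rw [mul_sub, hpP, sub_self]
  refine ⟨P, isMprojection_of_norm_apply_add_sub_le (fun x => ?_) fun x y => ?_, fun t x hx => ?_,
    fun x hx => ?_⟩
  · refine ext_predual e fun φ => tendsto_nhds_unique (hP _ φ) ?_
    simpa only [LinearMap.mulLeft_apply, hqP] using hP x φ
  · refine norm_le_of_ultralimit e (𝒰 := .of atTop) (x := fun S => q S * x + (y - q S * y))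
      (fun S => norm_apply_add_sub_le_of_isMprojection (hq S).isMprojection x y) fun φ => ?_
    simpa using (hP x φ).add ((hP y φ).const_sub (e y φ))
  · refine ext_predual e fun φ => eq_of_tendsto_ultrafilter_finset (hP x φ) t fun S hS => ?_
    rw [LinearMap.mulLeft_apply, ← hx, ← mul_assoc, ((hq S).comm _).eq, hpq S t hS]
  · refine ext_predual e fun φ => tendsto_nhds_unique (hP x φ) ?_
    simp only [LinearMap.mulLeft_apply, hq_zero _ x fun t _ => hx t, map_zero]
    exact tendsto_const_nhds

theorem eq_zero_of_forall_mul_eq_zero [CompleteSpace F] (e : N ≃ₗᵢ[ℂ] StrongDual ℂ F)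
    (hp : ∀ t, IsCentralProjection (p t))
    (hsep : ∀ ψ : F, (∀ t x, p t * x = x → e x ψ = 0) → ψ = 0) {x : N} (hx : ∀ t, p t * x = 0) :
    x = 0 := by
  obtain ⟨P, hP, hP_fix, hP_zero⟩ := exists_isMprojection_sup e hp
  have hP_id (y : N) : P y = y := by
    refine ext_predual e fun φ => ?_
    obtain ⟨ψ, hψ⟩ := exists_predual_of_isMprojection (e := e) hP φ
    have hψφ : ψ - φ = 0 := hsep _ fun t x hx => by
      rw [map_sub, ← hψ, hP_fix t x hx, sub_self]
    rw [hψ, sub_eq_zero.1 hψφ]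
  rw [← hP_id x, hP_zero x hx]

end CStar

end IsCentralProjection

/-! ### Uniqueness of enveloping actions -/

section Uniqueness

variable {G : Type*} {M : Type*} [CStarAlgebra M]
  {N : Type*} [NonUnitalCStarAlgebra N] {F : Type*} [NormedAddCommGroup F] [NormedSpace ℂ F]
  {N' : Type*} [NonUnitalCStarAlgebra N'] {F' : Type*} [NormedAddCommGroup F'] [NormedSpace ℂ F']

/-- All translates of `x` and `x'` have the same component in `M`. This is the graph of the
isomorphism between two enveloping actions. -/
def SameRestrictions (σ : G → N →⋆ₙₐ[ℂ] N) (ι : M →⋆ₙₐ[ℂ] N) (σ' : G → N' →⋆ₙₐ[ℂ] N')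
    (ι' : M →⋆ₙₐ[ℂ] N') (x : N) (x' : N') : Prop :=
  ∀ t, ∃ m, ι m = ι 1 * σ t x ∧ ι' m = ι' 1 * σ' t x'

variable {e : N ≃ₗᵢ[ℂ] StrongDual ℂ F} {σ : G → N →⋆ₙₐ[ℂ] N} {ι : M →⋆ₙₐ[ℂ] N}
  {e' : N' ≃ₗᵢ[ℂ] StrongDual ℂ F'} {σ' : G → N' →⋆ₙₐ[ℂ] N'} {ι' : M →⋆ₙₐ[ℂ] N'}

namespace SameRestrictions

variable {x y : N} {x' y' : N'}

theorem symm (hx : SameRestrictions σ ι σ' ι' x x') : SameRestrictions σ' ι' σ ι x' x :=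
  fun t => (hx t).imp fun _ => And.symm

theorem add (hx : SameRestrictions σ ι σ' ι' x x') (hy : SameRestrictions σ ι σ' ι' y y') :
    SameRestrictions σ ι σ' ι' (x + y) (x' + y') := fun t => by
  obtain ⟨m, hm, hm'⟩ := hx t
  obtain ⟨n, hn, hn'⟩ := hy t
  exact ⟨m + n, by simp [hm, hn, mul_add], by simp [hm', hn', mul_add]⟩

theorem smul (c : ℂ) (hx : SameRestrictions σ ι σ' ι' x x') :
    SameRestrictions σ ι σ' ι' (c • x) (c • x') := fun t => by
  obtain ⟨m, hm, hm'⟩ := hx t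
  exact ⟨c • m, by simp [hm, mul_smul_comm], by simp [hm', mul_smul_comm]⟩

theorem mul (hι : IsCentralProjection (ι 1)) (hι' : IsCentralProjection (ι' 1))
    (hx : SameRestrictions σ ι σ' ι' x x') (hy : SameRestrictions σ ι σ' ι' y y') :
    SameRestrictions σ ι σ' ι' (x * y) (x' * y') := fun t => by
  obtain ⟨m, hm, hm'⟩ := hx t
  obtain ⟨n, hn, hn'⟩ := hy t
  exact ⟨m * n, by rw [map_mul, hm, hn, map_mul, hι.mul_mul_mul_self],
    by rw [map_mul, hm', hn', map_mul, hι'.mul_mul_mul_self]⟩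

theorem star (hι : IsCentralProjection (ι 1)) (hι' : IsCentralProjection (ι' 1))
    (hx : SameRestrictions σ ι σ' ι' x x') :
    SameRestrictions σ ι σ' ι' (star x) (star x') := fun t => by
  obtain ⟨m, hm, hm'⟩ := hx t
  exact ⟨Star.star m,
    by rw [map_star, hm, star_mul, hι.isSelfAdjoint.star_eq, map_star, (hι.comm _).eq],
    by rw [map_star, hm', star_mul, hι'.isSelfAdjoint.star_eq, map_star, (hι'.comm _).eq]⟩

theorem act [Mul G] (hσ : ∀ s t x, σ (s * t) x = σ s (σ t x))
    (hσ' : ∀ s t x, σ' (s * t) x = σ' s (σ' t x)) (hx : SameRestrictions σ ι σ' ι' x x') (s : G) :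
    SameRestrictions σ ι σ' ι' (σ s x) (σ' s x') := fun t => by
  simpa only [← hσ, ← hσ'] using hx (t * s)

end SameRestrictions

variable [Group G]

/-- `M` is embedded as an ideal of `N`, and its translates under the action `σ` separate the points
of the predual of `N`. This is the algebraic part of the notion of a W*-enveloping action, in terms
of bundled *-homomorphisms. -/
structure IsEnvelopingIdeal (e : N ≃ₗᵢ[ℂ] StrongDual ℂ F) (σ : G → N →⋆ₙₐ[ℂ] N)
    (ι : M →⋆ₙₐ[ℂ] N) : Prop where
  injective : Function.Injective ι
  mul_left : ∀ a x, ∃ y, ι y = a * ι x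
  mul_right : ∀ a x, ∃ y, ι y = ι x * a
  act_one : ∀ x, σ 1 x = x
  act_mul : ∀ s t x, σ (s * t) x = σ s (σ t x)
  separating : ∀ ψ : F, (∀ t m, e (σ t (ι m)) ψ = 0) → ψ = 0

namespace IsEnvelopingIdeal

theorem act_act_inv (h : IsEnvelopingIdeal e σ ι) (t : G) (x : N) : σ t (σ t⁻¹ x) = x := by
  rw [← h.act_mul, mul_inv_cancel, h.act_one]

theorem isCentralProjection_one (h : IsEnvelopingIdeal e σ ι) : IsCentralProjection (ι 1) where
  isSelfAdjoint := (IsSelfAdjoint.one M).map ι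
  isIdempotentElem := IsIdempotentElem.one.map ι
  comm x := by
    obtain ⟨y, hy⟩ := h.mul_left x 1
    obtain ⟨z, hz⟩ := h.mul_right x 1
    have hleft : ι 1 * (x * ι 1) = x * ι 1 := by rw [← hy, ← map_mul, one_mul]
    have hright : ι 1 * x * ι 1 = ι 1 * x := by rw [← hz, ← map_mul, mul_one]
    rw [commute_iff_eq, ← hright, mul_assoc, hleft]

theorem isCentralProjection (h : IsEnvelopingIdeal e σ ι) (t : G) :
    IsCentralProjection (σ t (ι 1)) where
  isSelfAdjoint := h.isCentralProjection_one.isSelfAdjoint.map (σ t)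
  isIdempotentElem := h.isCentralProjection_one.isIdempotentElem.map (σ t)
  comm x := by
    rw [← h.act_act_inv t x]
    exact (h.isCentralProjection_one.comm _).map (σ t)

theorem ext [CompleteSpace F] (h : IsEnvelopingIdeal e σ ι) {x y : N}
    (hxy : ∀ t, ι 1 * σ t x = ι 1 * σ t y) : x = y := by
  rw [← sub_eq_zero]
  refine IsCentralProjection.eq_zero_of_forall_mul_eq_zero e h.isCentralProjection
    (fun ψ hψ => h.separating ψ fun t m => hψ t _ ?_) fun t => ?_
  · rw [← map_mul, ← map_mul, one_mul]
  · rw [← h.act_act_inv t (x - y), ← map_mul, map_sub, mul_sub, hxy, sub_self, map_zero]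

/-- The unit of the ideal `ι M ∩ σ r⁻¹ (ι M)` is mapped by `σ r` to that of `ι M ∩ σ r (ι M)`, so
cutting down by these units turns the claim into an identity within `M`. -/
theorem mul_act_eq_act_mul (h' : IsEnvelopingIdeal e' σ' ι')
    (hσσ' : ∀ r y y', σ r (ι y) = ι y' ↔ σ' r (ι' y) = ι' y') {r : G} {x : N} {m m' : M}
    (hm : ι m = ι 1 * x) (hm' : ι m' = ι 1 * σ r x) :
    ι' 1 * σ' r (ι' m) = σ' r (ι' 1) * ι' m' := by
  obtain ⟨u, hu⟩ := h'.mul_right (σ' r⁻¹ (ι' 1)) 1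
  obtain ⟨u', hu'⟩ := h'.mul_right (σ' r (ι' 1)) 1
  have hcomm := (h'.isCentralProjection_one.comm (σ' r (ι' 1))).eq
  have hone (n : M) : ι' 1 * ι' n = ι' n := by rw [← map_mul, one_mul]
  have hu_act : σ r (ι u) = ι u' := by
    rw [hσσ', hu, hu', map_mul, h'.act_act_inv, hcomm]
  have hum_act : σ r (ι (u * m)) = ι (u' * m') := by
    rw [map_mul, hm, ← mul_assoc, ← map_mul ι, mul_one, map_mul (σ r), hu_act, map_mul, hm',
      ← mul_assoc, ← map_mul ι, mul_one]
  have hum_act' := (hσσ' r _ _).1 hum_act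
  rw [map_mul ι', map_mul (σ' r), hu, map_mul (σ' r), h'.act_act_inv, map_mul ι', hu'] at hum_act'
  calc ι' 1 * σ' r (ι' m) = ι' 1 * (σ' r (ι' 1) * σ' r (ι' m)) := by rw [← map_mul (σ' r), hone]
    _ = ι' 1 * σ' r (ι' 1) * ι' m' := by rw [← mul_assoc, hcomm, hum_act', hcomm]
    _ = σ' r (ι' 1) * ι' m' := by rw [hcomm, mul_assoc, hone]

theorem exists_sameRestrictions (h : IsEnvelopingIdeal e σ ι) (h' : IsEnvelopingIdeal e' σ' ι')
    (hσσ' : ∀ r y y', σ r (ι y) = ι y' ↔ σ' r (ι' y) = ι' y') (x : N) :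
    ∃ x', ‖x'‖ ≤ ‖x‖ ∧ SameRestrictions σ ι σ' ι' x x' := by
  choose f hf using fun t => h.mul_right (σ t⁻¹ x) 1
  have hcompat (s t : G) :
      σ' s (ι' 1) * σ' t (ι' (f t)) = σ' t (ι' 1) * σ' s (ι' (f s)) := by
    have hx : σ (s⁻¹ * t) (σ t⁻¹ x) = σ s⁻¹ x := by rw [← h.act_mul, mul_inv_cancel_right]
    have := congrArg (σ' s) (h'.mul_act_eq_act_mul hσσ' (hf t) (by rw [hf s, hx]))
    rwa [map_mul, map_mul, ← h'.act_mul, ← h'.act_mul, mul_inv_cancel_left] at this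
  have hnorm (t : G) : ‖σ' t (ι' (f t))‖ ≤ ‖x‖ :=
    calc ‖σ' t (ι' (f t))‖ ≤ ‖ι' (f t)‖ := NonUnitalStarAlgHom.norm_apply_le _ _
      _ ≤ ‖f t‖ := NonUnitalStarAlgHom.norm_apply_le _ _
      _ = ‖ι 1 * σ t⁻¹ x‖ := by rw [← hf, NonUnitalStarAlgHom.norm_map ι h.injective]
      _ ≤ ‖σ t⁻¹ x‖ := h.isCentralProjection_one.norm_mul_le _
      _ ≤ ‖x‖ := NonUnitalStarAlgHom.norm_apply_le _ _
  obtain ⟨x', hx'_norm, hx'⟩ := IsCentralProjection.exists_glue e' h'.isCentralProjection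
    (fun t => by rw [← map_mul, ← map_mul, one_mul]) hcompat (norm_nonneg x) hnorm
  refine ⟨x', hx'_norm, fun t => ⟨f t⁻¹, by rw [hf, inv_inv], ?_⟩⟩
  have := congrArg (σ' t) (hx' t⁻¹)
  rw [map_mul, h'.act_act_inv, h'.act_act_inv] at this
  exact this.symm

theorem sameRestrictions_unique [CompleteSpace F'] (h' : IsEnvelopingIdeal e' σ' ι')
    (hι : Function.Injective ι) {x : N} {x' x'' : N'}
    (hx' : SameRestrictions σ ι σ' ι' x x') (hx'' : SameRestrictions σ ι σ' ι' x x'') :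
    x' = x'' := by
  refine h'.ext fun t => ?_
  obtain ⟨m, hm, hm'⟩ := hx' t
  obtain ⟨n, hn, hn'⟩ := hx'' t
  rw [← hm', ← hn', hι (hm.trans hn.symm)]

theorem exists_equiv [CompleteSpace F] [CompleteSpace F'] (h : IsEnvelopingIdeal e σ ι)
    (h' : IsEnvelopingIdeal e' σ' ι')
    (hσσ' : ∀ r y y', σ r (ι y) = ι y' ↔ σ' r (ι' y) = ι' y') :
    ∃ θ : N ≃ₗᵢ[ℂ] N', (∀ x y, θ (x * y) = θ x * θ y) ∧ (∀ x, θ (star x) = star (θ x)) ∧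
      ∀ t x, θ (σ t x) = σ' t (θ x) := by
  choose θ hθ_norm hθ using h.exists_sameRestrictions h' hσσ'
  choose θ' hθ'_norm hθ' using h'.exists_sameRestrictions h fun r y y' => (hσσ' r y y').symm
  have hθ_eq {x : N} {x' : N'} (hx : SameRestrictions σ ι σ' ι' x x') : θ x = x' :=
    h'.sameRestrictions_unique h.injective (hθ x) hx
  have left_inv (x : N) : θ' (θ x) = x :=
    h.sameRestrictions_unique h'.injective (hθ' _) (hθ x).symm
  have right_inv (x' : N') : θ (θ' x') = x' := hθ_eq (hθ' x').symm
  have hι := h.isCentralProjection_one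
  have hι' := h'.isCentralProjection_one
  exact ⟨{ toFun := θ
           invFun := θ'
           left_inv := left_inv
           right_inv := right_inv
           map_add' := fun x y => hθ_eq ((hθ x).add (hθ y))
           map_smul' := fun c x => hθ_eq ((hθ x).smul c)
           norm_map' := fun x =>
             (hθ_norm x).antisymm (by simpa only [left_inv] using hθ'_norm (θ x)) },
    fun x y => hθ_eq ((hθ x).mul hι hι' (hθ y)), fun x => hθ_eq ((hθ x).star hι hι'),
    fun t x => hθ_eq ((hθ x).act h.act_mul h'.act_mul t)⟩

end IsEnvelopingIdeal

end Uniqueness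

section WStarType

variable {E : Type*} [NormedAddCommGroup E] [NormedSpace ℂ E] {M : DualStarAlgebra E}

/-- The C*-algebra underlying a W*-algebra: a copy of the dual space carrying the operations of `M`
as instances. -/
def WStarType (_ : M.IsWStarAlgebra) : Type _ := StrongDual ℂ E

namespace WStarType

variable (h : M.IsWStarAlgebra)

instance : NormedAddCommGroup (WStarType h) := inferInstanceAs (NormedAddCommGroup (StrongDual ℂ E))

instance : NormedSpace ℂ (WStarType h) := inferInstanceAs (NormedSpace ℂ (StrongDual ℂ E))

instance : CompleteSpace (WStarType h) := inferInstanceAs (CompleteSpace (StrongDual ℂ E))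

instance : NormedRing (WStarType h) where
  mul := M.mul
  one := h.exists_one.choose
  left_distrib := h.mul_add
  right_distrib := h.add_mul
  mul_assoc := h.mul_assoc
  one_mul x := (h.exists_one.choose_spec x).1
  mul_one x := (h.exists_one.choose_spec x).2
  zero_mul x := (AddMonoidHom.mk' (M.mul · x) (h.add_mul · · x)).map_zero
  mul_zero x := (AddMonoidHom.mk' (M.mul x) (h.mul_add x)).map_zero
  neg_add_cancel := neg_add_cancel
  zsmul n x := n • x
  zsmul_zero' := SubNegMonoid.zsmul_zero'
  zsmul_succ' := SubNegMonoid.zsmul_succ'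
  zsmul_neg' := SubNegMonoid.zsmul_neg'
  dist_eq := NormedAddCommGroup.dist_eq
  norm_mul_le := h.norm_mul_le

instance : NormedAlgebra ℂ (WStarType h) where
  __ := Algebra.ofModule (A := WStarType h) h.smul_mul h.mul_smul
  norm_smul_le := norm_smul_le

instance : StarRing (WStarType h) where
  star := M.star
  star_involutive := h.star_star
  star_mul := h.star_mul
  star_add := h.star_add

instance : CStarAlgebra (WStarType h) where
  norm_mul_self_le x := (h.norm_star_mul_self x).ge
  star_smul := h.star_smul

/-- The identification of a W*-algebra with the dual of its predual. -/
def dualEquiv : WStarType h ≃ₗᵢ[ℂ] StrongDual ℂ E :=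
  LinearIsometryEquiv.refl ℂ (StrongDual ℂ E)

variable {h} {F : Type*} [NormedAddCommGroup F] [NormedSpace ℂ F] {N : DualStarAlgebra F}

/-- A multiplicative *-preserving linear map of W*-algebras as a *-homomorphism. -/
def starHom (hN : N.IsWStarAlgebra) (f : StrongDual ℂ E →ₗ[ℂ] StrongDual ℂ F)
    (map_mul : ∀ x y, f (M.mul x y) = N.mul (f x) (f y))
    (map_star : ∀ x, f (M.star x) = N.star (f x)) : WStarType h →⋆ₙₐ[ℂ] WStarType hN where
  toFun := f
  map_smul' := f.map_smul
  map_zero' := f.map_zero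
  map_add' := f.map_add
  map_mul' := map_mul
  map_star' := map_star

end WStarType

end WStarType

namespace IsWStarEnveloping

variable {G : Type v} [Group G] {E : Type*} [NormedAddCommGroup E] [NormedSpace ℂ E]
  {F : Type*} [NormedAddCommGroup F] [NormedSpace ℂ F]
  {F' : Type*} [NormedAddCommGroup F'] [NormedSpace ℂ F']
  {M : DualStarAlgebra E} {γ : PartialFamily G (StrongDual ℂ E)}
  {N : DualStarAlgebra F} {σ : G → StrongDual ℂ F →ₗ[ℂ] StrongDual ℂ F}
  {ι : StrongDual ℂ E →ₗ[ℂ] StrongDual ℂ F}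
  {N' : DualStarAlgebra F'} {σ' : G → StrongDual ℂ F' →ₗ[ℂ] StrongDual ℂ F'}
  {ι' : StrongDual ℂ E →ₗ[ℂ] StrongDual ℂ F'}

theorem injective (h : IsWStarEnveloping M γ N σ ι) : Function.Injective ι := by
  let := wstar E
  let := wstar F
  exact h.wstar_embedding.injective

theorem act_eq_iff (h : IsWStarEnveloping M γ N σ ι) (t : G) (x y : StrongDual ℂ E) :
    σ t (ι x) = ι y ↔ ∃ hx : x ∈ γ.dom t⁻¹, (γ.act t ⟨x, hx⟩ : StrongDual ℂ E) = y := by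
  constructor
  · intro hxy
    refine ⟨(h.isWStarAction.mem_dom_inv_iff h.injective h.map_dom).2 ⟨y, hxy.symm⟩, ?_⟩
    exact h.injective (by rw [h.map_act, hxy])
  · rintro ⟨hx, rfl⟩
    exact (h.map_act t ⟨x, hx⟩).symm

theorem isEnvelopingIdeal (h : IsWStarEnveloping M γ N σ ι) :
    IsEnvelopingIdeal (WStarType.dualEquiv h.isWStarAction.isWStarAlgebra)
      (fun t => WStarType.starHom h.isWStarAction.isWStarAlgebra (σ t)
        (h.isWStarAction.map_mul t) (h.isWStarAction.map_star t))
      (WStarType.starHom (h := h.isWStarPartialAction.isWStarAlgebra)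
        h.isWStarAction.isWStarAlgebra ι h.map_mul h.map_star) where
  injective := h.injective
  mul_left a x := h.ideal.mul_mem_left a (ι x) ⟨x, rfl⟩
  mul_right a x := h.ideal.mul_mem_right a (ι x) ⟨x, rfl⟩
  act_one := h.isWStarAction.act_one
  act_mul := h.isWStarAction.act_mul
  separating φ hφ := by
    refine (wstar_closure_span_eq_univ_iff _).1 h.dense φ fun x hx => ?_
    obtain ⟨t, _, ⟨m, rfl⟩, rfl⟩ := Set.mem_iUnion.1 hx
    exact hφ t m

theorem exists_equiv (h : IsWStarEnveloping M γ N σ ι) (h' : IsWStarEnveloping M γ N' σ' ι') :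
    ∃ θ : StrongDual ℂ F ≃ₗᵢ[ℂ] StrongDual ℂ F', (∀ x y, θ (N.mul x y) = N'.mul (θ x) (θ y)) ∧
      (∀ x, θ (N.star x) = N'.star (θ x)) ∧ ∀ t x, θ (σ t x) = σ' t (θ x) := by
  have := h.isWStarAction.isWStarAlgebra.complete
  have := h'.isWStarAction.isWStarAlgebra.complete
  exact h.isEnvelopingIdeal.exists_equiv h'.isEnvelopingIdeal fun r y y' =>
    (h.act_eq_iff r y y').trans (h'.act_eq_iff r y y').symm

end IsWStarEnveloping

/-! ### Isomorphism invariance of amenability -/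

section LpMap

variable {I X Y : Type*} [NormedAddCommGroup X] [NormedSpace ℂ X] [NormedAddCommGroup Y]
  [NormedSpace ℂ Y]

/-- Pointwise application of a linear isometry to a bounded function. -/
def lpInftyMap (θ : X →ₗᵢ[ℂ] Y) : lp (fun _ : I => X) ∞ →ₗ[ℂ] lp (fun _ : I => Y) ∞ where
  toFun f := ⟨fun r => θ (f r), memℓp_infty ⟨‖f‖, by
    rintro _ ⟨r, rfl⟩
    exact (θ.norm_map _).trans_le (lp.norm_apply_le_norm ENNReal.top_ne_zero f r)⟩⟩
  map_add' f g := by ext r; exact θ.map_add _ _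
  map_smul' c f := by ext r; exact θ.map_smul _ _

theorem norm_lpInftyMap_le (θ : X →ₗᵢ[ℂ] Y) (f : lp (fun _ : I => X) ∞) :
    ‖lpInftyMap θ f‖ ≤ ‖f‖ :=
  lp.norm_le_of_forall_le (norm_nonneg _) fun r =>
    (θ.norm_map _).trans_le (lp.norm_apply_le_norm ENNReal.top_ne_zero f r)

end LpMap

section Transport

variable {F F' : Type*} [NormedAddCommGroup F] [NormedSpace ℂ F]
  [NormedAddCommGroup F'] [NormedSpace ℂ F'] {N : DualStarAlgebra F} {N' : DualStarAlgebra F'}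

theorem WStarADAmenable.of_equiv {G : Type*} [Group G]
    {σ : G → StrongDual ℂ F →ₗ[ℂ] StrongDual ℂ F}
    {σ' : G → StrongDual ℂ F' →ₗ[ℂ] StrongDual ℂ F'} (h : WStarADAmenable N σ)
    (θ : StrongDual ℂ F ≃ₗᵢ[ℂ] StrongDual ℂ F')
    (map_mul : ∀ x y, θ (N.mul x y) = N'.mul (θ x) (θ y))
    (map_star : ∀ x, θ (N.star x) = N'.star (θ x)) (map_act : ∀ t x, θ (σ t x) = σ' t (θ x)) :
    WStarADAmenable N' σ' := by
  obtain ⟨P, P_pos, norm_P_le, P_act, P_const⟩ := h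
  let τ := lpInftyMap (I := G) θ.symm.toLinearIsometry
  have apply_τ (f : lp (fun _ : G => StrongDual ℂ F') ∞) (r : G) : θ (τ f r) = f r :=
    θ.apply_symm_apply (f r)
  refine ⟨θ.toLinearEquiv.toLinearMap ∘ₗ P ∘ₗ τ, fun f k hf => ?_, fun f => ?_,
    fun t f g hfg => ?_, fun x f hf => ?_⟩
  · obtain ⟨y, hy⟩ := P_pos (τ f) (τ k) fun r => θ.injective <| by
      rw [map_mul, map_star, apply_τ, apply_τ, hf]
    exact ⟨θ y, (congrArg θ hy).trans (by rw [map_mul, map_star])⟩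
  · exact (θ.norm_map _).trans_le ((norm_P_le _).trans (norm_lpInftyMap_le _ f))
  · have hτ : P (τ g) = σ t (P (τ f)) := P_act t (τ f) (τ g) fun r => θ.injective <| by
      rw [map_act, apply_τ, apply_τ, hfg]
    exact (congrArg θ hτ).trans (map_act t _)
  · have hτ : P (τ f) = θ.symm x := P_const (θ.symm x) (τ f) fun r => θ.injective <| by
      rw [apply_τ, hf, θ.apply_symm_apply]
    exact (congrArg θ hτ).trans (θ.apply_symm_apply x)

/-- The isometry of dual spaces induced by an isometry of preduals. -/
def dualIsometry (k : F' ≃ₗᵢ[ℂ] F) : StrongDual ℂ F ≃ₗᵢ[ℂ] StrongDual ℂ F' where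
  toFun x := x.comp (k : F' →L[ℂ] F)
  invFun x := x.comp (k.symm : F →L[ℂ] F')
  left_inv x := by ext; simp
  right_inv x := by ext; simp
  map_add' x y := rfl
  map_smul' c x := rfl
  norm_map' x := x.opNorm_comp_linearIsometryEquiv k

/-- The homeomorphism of weak-* topologies induced by an isometry of preduals. -/
def dualHomeomorph (k : F' ≃ₗᵢ[ℂ] F) :
    @Homeomorph (StrongDual ℂ F) (StrongDual ℂ F') (wstar F) (wstar F') :=
  letI := wstar F
  letI := wstar F'
  { (dualIsometry k).toLinearEquiv.toEquiv with
    continuous_toFun := (continuous_wstar_iff _ _).2 fun φ => continuous_wstar_eval (k φ)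
    continuous_invFun := (continuous_wstar_iff _ _).2 fun φ => continuous_wstar_eval (k.symm φ) }

namespace DualStarAlgebra

/-- Transport of the multiplication and the involution along an isometry of preduals. -/
def transport (N : DualStarAlgebra F) (k : F' ≃ₗᵢ[ℂ] F) : DualStarAlgebra F' where
  mul x y := dualIsometry k (N.mul ((dualIsometry k).symm x) ((dualIsometry k).symm y))
  star x := dualIsometry k (N.star ((dualIsometry k).symm x))

variable (k : F' ≃ₗᵢ[ℂ] F)

theorem dualIsometry_mul (x y : StrongDual ℂ F) :
    dualIsometry k (N.mul x y) = (N.transport k).mul (dualIsometry k x) (dualIsometry k y) := by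
  simp [transport]

theorem dualIsometry_star (x : StrongDual ℂ F) :
    dualIsometry k (N.star x) = (N.transport k).star (dualIsometry k x) := by
  simp [transport]

theorem IsWStarAlgebra.transport (hN : N.IsWStarAlgebra) : (N.transport k).IsWStarAlgebra where
  complete := by
    have := hN.complete
    exact (completeSpace_congr (e := k.toEquiv) k.isometry.isUniformEmbedding).2 this
  mul_assoc x y z := by simp [DualStarAlgebra.transport, hN.mul_assoc]
  add_mul x y z := by simp [DualStarAlgebra.transport, hN.add_mul]
  mul_add x y z := by simp [DualStarAlgebra.transport, hN.mul_add]
  smul_mul c x y := by simp [DualStarAlgebra.transport, hN.smul_mul]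
  mul_smul c x y := by simp [DualStarAlgebra.transport, hN.mul_smul]
  exists_one := by
    obtain ⟨u, hu⟩ := hN.exists_one
    exact ⟨dualIsometry k u, fun x => by simp [DualStarAlgebra.transport, hu]⟩
  star_star x := by simp [DualStarAlgebra.transport, hN.star_star]
  star_add x y := by simp [DualStarAlgebra.transport, hN.star_add]
  star_smul c x := by simp [DualStarAlgebra.transport, hN.star_smul]
  star_mul x y := by simp [DualStarAlgebra.transport, hN.star_mul]
  norm_mul_le x y := by
    simpa [DualStarAlgebra.transport] using
      hN.norm_mul_le ((dualIsometry k).symm x) ((dualIsometry k).symm y)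
  norm_star_mul_self x := by
    simpa [DualStarAlgebra.transport] using hN.norm_star_mul_self ((dualIsometry k).symm x)

theorem IsWStarIdeal.transport {I : Submodule ℂ (StrongDual ℂ F)} (hI : N.IsWStarIdeal I) :
    (N.transport k).IsWStarIdeal (I.map (dualIsometry k).toLinearEquiv.toLinearMap) where
  mul_mem_left a := by
    rintro _ ⟨x, hx, rfl⟩
    exact ⟨_, hI.mul_mem_left ((dualIsometry k).symm a) x hx, by simp [DualStarAlgebra.transport]⟩
  mul_mem_right a := by
    rintro _ ⟨x, hx, rfl⟩
    exact ⟨_, hI.mul_mem_right ((dualIsometry k).symm a) x hx, by simp [DualStarAlgebra.transport]⟩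
  star_mem := by
    rintro _ ⟨x, hx, rfl⟩
    exact ⟨_, hI.star_mem x hx, dualIsometry_star k x⟩
  isClosed := by
    let := wstar F
    let := wstar F'
    exact (dualHomeomorph k).isClosedMap _ hI.isClosed

end DualStarAlgebra

/-- Transport of an action along an isometry of preduals. -/
def transportAction {G : Type*} (σ : G → StrongDual ℂ F →ₗ[ℂ] StrongDual ℂ F) (k : F' ≃ₗᵢ[ℂ] F)
    (t : G) : StrongDual ℂ F' →ₗ[ℂ] StrongDual ℂ F' :=
  (dualIsometry k).toLinearEquiv.toLinearMap ∘ₗ σ t ∘ₗ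
    (dualIsometry k).symm.toLinearEquiv.toLinearMap

theorem transportAction_apply {G : Type*} (σ : G → StrongDual ℂ F →ₗ[ℂ] StrongDual ℂ F)
    (k : F' ≃ₗᵢ[ℂ] F) (t : G) (x : StrongDual ℂ F') :
    transportAction σ k t x = dualIsometry k (σ t ((dualIsometry k).symm x)) := rfl

theorem dualIsometry_act {G : Type*} (σ : G → StrongDual ℂ F →ₗ[ℂ] StrongDual ℂ F)
    (k : F' ≃ₗᵢ[ℂ] F) (t : G) (x : StrongDual ℂ F) :
    dualIsometry k (σ t x) = transportAction σ k t (dualIsometry k x) := by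
  rw [transportAction_apply, LinearIsometryEquiv.symm_apply_apply]

variable {G : Type v} [Group G] {σ : G → StrongDual ℂ F →ₗ[ℂ] StrongDual ℂ F}

theorem IsWStarAction.transport (hσ : IsWStarAction N σ) (k : F' ≃ₗᵢ[ℂ] F) :
    IsWStarAction (N.transport k) (transportAction σ k) where
  isWStarAlgebra := hσ.isWStarAlgebra.transport k
  map_mul t x y := by simp [DualStarAlgebra.transport, transportAction_apply, hσ.map_mul]
  map_star t x := by simp [DualStarAlgebra.transport, transportAction_apply, hσ.map_star]
  wstar_continuous t := by
    let := wstar F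
    let := wstar F'
    exact (dualHomeomorph k).continuous.comp
      ((hσ.wstar_continuous t).comp (dualHomeomorph k).symm.continuous)
  act_one x := by simp [transportAction_apply, hσ.act_one]
  act_mul s t x := by simp [transportAction_apply, hσ.act_mul]

variable {E : Type*} [NormedAddCommGroup E] [NormedSpace ℂ E] {M : DualStarAlgebra E}
  {γ : PartialFamily G (StrongDual ℂ E)} {ι : StrongDual ℂ E →ₗ[ℂ] StrongDual ℂ F}

theorem IsWStarEnveloping.transport (h : IsWStarEnveloping M γ N σ ι) (k : F' ≃ₗᵢ[ℂ] F) :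
    IsWStarEnveloping M γ (N.transport k) (transportAction σ k)
      ((dualIsometry k).toLinearEquiv.toLinearMap ∘ₗ ι) where
  isWStarPartialAction := h.isWStarPartialAction
  isWStarAction := h.isWStarAction.transport k
  ideal := by
    rw [LinearMap.range_comp]
    exact h.ideal.transport k
  map_mul x y := by
    simpa [h.map_mul] using DualStarAlgebra.dualIsometry_mul k (ι x) (ι y)
  map_star x := by
    simpa [h.map_star] using DualStarAlgebra.dualIsometry_star k (ι x)
  wstar_embedding := by
    let := wstar E
    let := wstar F
    let := wstar F'
    exact (dualHomeomorph k).isEmbedding.comp h.wstar_embedding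
  map_dom t := by
    have himage : transportAction σ k t '' (dualIsometry k '' Set.range ι) =
        dualIsometry k '' (σ t '' Set.range ι) := by
      simp only [Set.image_image, dualIsometry_act]
    have hrange : Set.range ((dualIsometry k).toLinearEquiv.toLinearMap ∘ₗ ι) =
        dualIsometry k '' Set.range ι := Set.range_comp (dualIsometry k) ι
    rw [hrange, himage, ← Set.image_inter (dualIsometry k).injective, ← h.map_dom]
    exact Set.image_comp (dualIsometry k) ι _
  map_act t x := by simp [h.map_act, dualIsometry_act]
  dense := by
    refine (wstar_closure_span_eq_univ_iff _).2 fun φ hφ => k.map_eq_zero_iff.1 ?_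
    refine (wstar_closure_span_eq_univ_iff _).1 h.dense (k φ) fun x hx => ?_
    obtain ⟨t, _, ⟨m, rfl⟩, rfl⟩ := Set.mem_iUnion.1 hx
    exact hφ (dualIsometry k (σ t (ι m)))
      (Set.mem_iUnion.2 ⟨t, _, ⟨m, rfl⟩, (dualIsometry_act σ k t (ι m)).symm⟩)

end Transport

theorem partialWStarADAmenable_iff {G : Type v} [Group G] {E F : Type u} [NormedAddCommGroup E]
    [NormedSpace ℂ E] [NormedAddCommGroup F] [NormedSpace ℂ F] {M : DualStarAlgebra E}
    {γ : PartialFamily G (StrongDual ℂ E)} {N : DualStarAlgebra F}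
    {σ : G → StrongDual ℂ F →ₗ[ℂ] StrongDual ℂ F} {ι : StrongDual ℂ E →ₗ[ℂ] StrongDual ℂ F}
    (h : IsWStarEnveloping M γ N σ ι) : PartialWStarADAmenable M γ ↔ WStarADAmenable N σ := by
  constructor
  · rintro ⟨F', _, _, N', σ', ι', h', hσ'⟩
    obtain ⟨θ, map_mul, map_star, map_act⟩ := h'.exists_equiv h
    exact hσ'.of_equiv θ map_mul map_star map_act
  · intro hσ
    -- The predual of an enveloping action is required to live in `Type (max u v)`.
    let k : ULift.{v} F ≃ₗᵢ[ℂ] F := LinearIsometryEquiv.ulift ℂ F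
    exact ⟨ULift.{v} F, inferInstance, inferInstance, N.transport k, transportAction σ k, _,
      h.transport k, hσ.of_equiv (dualIsometry k) (DualStarAlgebra.dualIsometry_mul k)
        (DualStarAlgebra.dualIsometry_star k) (dualIsometry_act σ k)⟩

end

theorem mainTheorem4 {G : Type v} [Group G] {B : Type u} [NonUnitalCStarAlgebra B]
    (β : G →* (B ≃⋆ₐ[ℂ] B)) (A : CStarIdeal B) (hA : IsCStarEnveloping β A) :
    IsWStarEnveloping (bidual A.alg) (restrictAction β A).bidual
        (bidual B) (bidualAction β) A.bidualIncl ∧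
      ((restrictAction β A).ADAmenable ↔ ADAmenable β) :=
  ⟨isWStarEnveloping_bidual β A hA, partialWStarADAmenable_iff (isWStarEnveloping_bidual β A hA)⟩
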